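/- Let $X$ be a finite metric graph: the geometric realization of a connected finite one-dimensional simplicial complex with edge set $E$ (a single vertex is allowed), with the length metric in which every edge has length $1$. For $\varepsilon>0$ let $p_\varepsilon(x)=\bar B(x,\varepsilon)$ be the closed ball of radius $\varepsilon$ about $x$, and let $p_\varepsilon(X)$ be the space $\{\bar B(x,\varepsilon) : x\in X\}$ with the Hausdorff metric. Write $\varepsilon=\tfrac{k}{2}+\varepsilon_0$ with $k$ an integer and $0\le\varepsilon_0<\tfrac12$, and put $a=\min(\varepsilon_0,\tfrac12-\varepsilon_0)$. Cut every edge of $X$ at its midpoint, and cut each of the two halves $(v,m)$ ($v$ a vertex, $m$ the midpoint) at the points at distance $a$ and $\tfrac12-a$ from $v$. This divides each edge into two open pieces if $\varepsilon_0=0$, four if $\varepsilon_0=\tfrac14$, and six otherwise. Let $N_0(\varepsilon)$ be the number of those pieces $A$ (over all edges) that are collapsed, that is, $\bar B(z,\varepsilon)=X$ for every $z\in A$. Then for every $\varepsilon>0$ the space $p_\varepsilon(X)$ is homeomorphic to a finite graph, and its Euler characteristic (number of vertices minus number of edges, in any triangulation) satisfies $$\chi(p_\varepsilon(X))\ \ge\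 1-6|E| ,\qquad\text{and more precisely}\qquad \chi(p_\varepsilon(X))\ \ge\ 1+N_0(\varepsilon)-6|E| .$$ Moreover $H_1(p_\varepsilon(X);\mathbb Z)$ (the simplicial homology of any triangulation) is isomorphic to $\mathbb Z^m$ with $m\le 6|E|-N_0(\varepsilon)$. -/

import Mathlib

open scoped ENNReal

noncomputable section

namespace MetricGraph

/-- A point of the geometric realization of the one-dimensional simplicial complex given by a
simple graph `G` on a finite vertex set: barycentric coordinates that vanish outside a vertex
(`u = v`) or outside the two endpoints of an edge (`G.Adj u v`). -/
@[ext]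
structure Point {V : Type*} [Fintype V] (G : SimpleGraph V) where
  coord : V → ℝ
  coord_nonneg : ∀ v, 0 ≤ coord v
  sum_coord : ∑ v, coord v = 1
  mem_simplex : ∃ u v, (u = v ∨ G.Adj u v) ∧ ∀ w, coord w ≠ 0 → w = u ∨ w = v

/-- `x` and `y` lie in a common closed simplex (a vertex or a closed edge). -/
def SameSimplex {V : Type*} [Fintype V] {G : SimpleGraph V} (x y : Point G) : Prop :=
  ∃ u v, (u = v ∨ G.Adj u v) ∧
    (∀ w, x.coord w ≠ 0 → w = u ∨ w = v) ∧ (∀ w, y.coord w ≠ 0 → w = u ∨ w = v)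

/-- `Chain x y l`: there is a finite sequence of points from `x` to `y`, any two consecutive ones
in a common closed edge, of total length `l`. For two points `x`, `y` of one edge, the sup distance
`edist x.coord y.coord` is their distance along that edge, the edge having length 1. -/
inductive Chain {V : Type*} [Fintype V] {G : SimpleGraph V} : Point G → Point G → ℝ≥0∞ → Prop
  | nil (x : Point G) : Chain x x 0
  | cons {x y z : Point G} {l : ℝ≥0∞} (h : SameSimplex x y) (c : Chain y z l) :
      Chain x z (edist x.coord y.coord + l)

section

variable {V : Type*} [Fintype V] {G : SimpleGraph V}

theorem SameSimplex.symm {x y : Point G} (h : SameSimplex x y) : SameSimplex y x := by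
  obtain ⟨u, v, huv, hx, hy⟩ := h
  exact ⟨u, v, huv, hy, hx⟩

theorem Chain.append {x y z : Point G} {l m : ℝ≥0∞} (h : Chain x y l) (k : Chain y z m) :
    Chain x z (l + m) := by
  induction h with
  | nil x => simpa using k
  | cons h _ ih => rw [add_assoc]; exact Chain.cons h (ih k)

theorem Chain.symm {x y : Point G} {l : ℝ≥0∞} (h : Chain x y l) : Chain y x l := by
  induction h with
  | nil x => exact Chain.nil x
  | @cons x y z l h _ ih =>
    have hc := ih.append (Chain.cons h.symm (Chain.nil x))
    rwa [add_zero, add_comm, edist_comm] at hc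

theorem Chain.edist_le {x y : Point G} {l : ℝ≥0∞} (h : Chain x y l) :
    edist x.coord y.coord ≤ l := by
  induction h with
  | nil x => simp
  | cons h _ ih => exact (edist_triangle _ _ _).trans (add_le_add le_rfl ih)

end

/-- The length metric in which every edge has length 1: the distance between two points is the
infimum of the lengths of the polygonal paths that join them (and `∞` if there is none, which does
not happen in a connected graph). -/
instance {V : Type*} [Fintype V] (G : SimpleGraph V) : EMetricSpace (Point G) where
  edist x y := ⨅ (l : ℝ≥0∞) (_ : Chain x y l), l
  edist_self x := le_antisymm (iInf₂_le 0 (Chain.nil x)) bot_le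
  edist_comm x y := le_antisymm (le_iInf₂ fun l h => iInf₂_le l h.symm)
    (le_iInf₂ fun l h => iInf₂_le l h.symm)
  edist_triangle x y z := by
    refine ENNReal.le_of_forall_pos_le_add fun ε hε hlt => ?_
    have hε' : (ε / 2 : ℝ≥0∞) ≠ 0 := by simpa using hε.ne'
    have h1 := ENNReal.lt_add_right (ne_top_of_le_ne_top hlt.ne le_self_add) hε'
    have h2 := ENNReal.lt_add_right (ne_top_of_le_ne_top hlt.ne le_add_self) hε'
    simp only [iInf_lt_iff] at h1 h2
    obtain ⟨l, hl, hl'⟩ := h1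
    obtain ⟨m, hm, hm'⟩ := h2
    refine (iInf₂_le (l + m) (hl.append hm)).trans ((add_le_add hl'.le hm'.le).trans ?_)
    rw [add_add_add_comm, ENNReal.add_halves]
  eq_of_edist_eq_zero {x y} h := by
    have h0 : edist x.coord y.coord ≤ 0 := by
      rw [← h]
      exact le_iInf₂ fun l hl => hl.edist_le
    exact Point.ext (edist_le_zero.mp h0)

/-- The map `p_ε` that sends a point of the metric graph to the closed ball of radius `ε` about it,
a point of the hyperspace of closed sets with the Hausdorff metric. -/
def ballMap {V : Type*} [Fintype V] (G : SimpleGraph V) (ε : ℝ) (x : Point G) :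
    TopologicalSpace.Closeds (Point G) :=
  ⟨Metric.closedEBall x (ENNReal.ofReal ε), Metric.isClosed_closedEBall⟩

/-- The projection `p_ε(X)`, a subspace of the hyperspace. -/
abbrev Projection {V : Type*} [Fintype V] (G : SimpleGraph V) (ε : ℝ) : Type _ :=
  Set.range (ballMap G ε)

/-- The point at distance `t` from the vertex `d.fst` on the edge from `d.fst` to `d.snd`. -/
def Point.onEdge {V : Type*} [Fintype V] {G : SimpleGraph V} (d : G.Dart) (t : ℝ)
    (ht : t ∈ Set.Icc (0 : ℝ) 1) : Point G := by
  classical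
  exact
  { coord := fun w => (if w = d.fst then 1 - t else 0) + (if w = d.snd then t else 0)
    coord_nonneg := fun w => by
      have h0 := ht.1
      have h1 := ht.2
      split_ifs <;> linarith
    sum_coord := by simp [Finset.sum_add_distrib]
    mem_simplex := ⟨d.fst, d.snd, Or.inr d.adj, fun w hw => by
      by_contra! h
      exact hw (by simp [h.1, h.2])⟩ }

/-- Write `ε = k / 2 + ε₀` with `k` an integer and `0 ≤ ε₀ < 1 / 2`. Each half-edge `(v, m)`
(`v` a vertex, `m` the midpoint of the edge) is cut at the points at distance `cut ε` and
`1 / 2 - cut ε` from `v`, where `cut ε = min ε₀ (1 / 2 - ε₀)`. -/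
def cut (ε : ℝ) : ℝ := min (ε - ⌊2 * ε⌋ / 2) (1 / 2 - (ε - ⌊2 * ε⌋ / 2))

/-- The three (possibly empty) open intervals into which the half-edge, parametrized by the distance
to its vertex, is cut. The middle one is empty when `ε₀ = 1 / 4`, the outer ones are empty when
`ε₀ = 0`; so an edge is cut into six pieces in general, four if `ε₀ = 1 / 4`, two if `ε₀ = 0`. -/
def pieceInterval (ε : ℝ) : Fin 3 → Set ℝ :=
  ![Set.Ioo 0 (cut ε), Set.Ioo (cut ε) (1 / 2 - cut ε), Set.Ioo (1 / 2 - cut ε) (1 / 2)]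

/-- The number of collapsed pieces: pairs of a half-edge (a half-edge is given by a dart: the edge
that contains it, oriented from the vertex of the half-edge) and a nonempty piece of it, such that
the closed ball of radius `ε` about every point of the piece is the whole graph. -/
def collapsedCount {V : Type*} [Fintype V] (G : SimpleGraph V) (ε : ℝ) : ℕ :=
  Set.ncard {p : G.Dart × Fin 3 | (pieceInterval ε p.2).Nonempty ∧
    ∀ t ∈ pieceInterval ε p.2, ∀ ht : t ∈ Set.Icc (0 : ℝ) 1,
      Metric.closedEBall (Point.onEdge p.1 t ht) (ENNReal.ofReal ε) = Set.univ}

/-- A finite graph structure on a topological space: a homeomorphism from the geometric realization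
of a finite simplicial complex of dimension at most one. -/
structure Triangulation (Y : Type*) [TopologicalSpace Y] where
  n : ℕ
  graph : SimpleGraph (Fin n)
  homeo : Point graph ≃ₜ Y

/-- The Euler characteristic of a finite graph: vertices minus edges. -/
def eulerChar {V : Type*} [Fintype V] (G : SimpleGraph V) : ℤ :=
  (Fintype.card V : ℤ) - (G.edgeSet.ncard : ℤ)

/-- Oriented simplicial 1-chains with integer coefficients: `c u v` is the coefficient of the edge
oriented from `u` to `v`, so that `c v u = -c u v`. -/
def oneChains {V : Type*} (G : SimpleGraph V) : AddSubgroup (V → V → ℤ) where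
  carrier := {c | (∀ u v, c v u = -c u v) ∧ ∀ u v, ¬G.Adj u v → c u v = 0}
  zero_mem' := by simp
  add_mem' {a b} ha hb := by
    refine ⟨fun u v => ?_, fun u v h => ?_⟩
    · simp only [Pi.add_apply, ha.1 u v, hb.1 u v]; ring
    · simp [ha.2 u v h, hb.2 u v h]
  neg_mem' {a} ha := by
    refine ⟨fun u v => ?_, fun u v h => ?_⟩
    · simp only [Pi.neg_apply, ha.1 u v]
    · simp [ha.2 u v h]

/-- The simplicial boundary operator from 1-chains to 0-chains; the boundary of the edge oriented
from `u` to `v` is `v - u`. -/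
def boundary {V : Type*} [Fintype V] (G : SimpleGraph V) : oneChains G →+ (V → ℤ) where
  toFun c v := ∑ u, c.1 u v
  map_zero' := by ext; simp
  map_add' a b := by ext; simp [Finset.sum_add_distrib]

/-- First simplicial homology group with integer coefficients. There are no 2-simplices, so it is
the group of 1-cycles. -/
abbrev H1 {V : Type*} [Fintype V] (G : SimpleGraph V) : AddSubgroup (oneChains G) :=
  (boundary G).ker

end MetricGraph

end

open scoped ENNReal

noncomputable section

namespace MetricGraph

section

variable {V : Type*} [Fintype V] {G : SimpleGraph V}

/-! ### Points of a metric graph -/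

/-! Balls in a length space move no faster than their centres, so `ballMap` is 1-Lipschitz
(`continuous_ballMap`). As the metric graph is compact, its projection is determined topologically
by which points have equal balls. Two facts control this.

Rigidity (`eq_of_closedEBall_seg_eq`): a ball that is not the whole graph has a frontier point on
some edge, at a coordinate `a` with `ε ≡ a ± t` mod 1, where `t` is the distance of the centre from
a vertex. Since `t` lies in `[0, 1/2]`, the ball determines `t`.

Constancy (`closedEBall_seg_congr`, `closedEBall_seg_eq_univ`): for points at distances `t, s ≤ 1/2`
from vertices, whether one lies in the ball about the other depends on the position of `(t, s)`
relative to the lines `±t ± s ∈ ε + ℤ`. Inside the square these lines cross each other, or meet its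
horizontal sides, only over cut points or ends of the half-edge. Over one open piece the pattern is
therefore constant, and equality of balls, or fullness of a ball, at one point of a piece spreads to
the whole piece.

Hence each piece that is not collapsed embeds as an open arc, two such arcs coincide point by point
or are disjoint, and everything else maps to finitely many nodes. There are at most `6|E| - N₀` arcs
(`projDecomposition`). Cutting each into three yields a simplicial graph.

The bounds concern an arbitrary triangulation `H`. Remove one point from each edge of `H` outside a
spanning tree: the rest is connected. Two removed points on one arc would disconnect it, so `|E(H)|
- |V(H)| + 1` is at most the number of arcs (`ncard_edgeSet_add_one_le`). The first homology is free
of rank at most the same quantity (`finrank_H1_add_card_le`). -/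

open Classical in
/-- A vertex, as a point of the geometric realization. -/
def vertex (G : SimpleGraph V) (v : V) : Point G where
  coord := Pi.single v 1
  coord_nonneg w := by by_cases h : w = v <;> simp [h]
  sum_coord := by simp
  mem_simplex := ⟨v, v, Or.inl rfl, fun w hw => Or.inl <| by
    by_contra h; exact hw (by simp [h])⟩

open Classical in
theorem vertex_coord (v w : V) : (vertex G v).coord w = if w = v then 1 else 0 := by
  simp [vertex, Pi.single_apply]

/-- The point at distance `t` from `d.fst` on the edge `d`, with `t` clamped to `[0, 1]`. -/
def seg (d : G.Dart) (t : ℝ) : Point G :=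
  Point.onEdge d (Set.projIcc 0 1 zero_le_one t) (Set.projIcc 0 1 zero_le_one t).2

theorem seg_eq_onEdge (d : G.Dart) {t : ℝ} (ht : t ∈ Set.Icc (0 : ℝ) 1) :
    seg d t = Point.onEdge d t ht := by
  simp only [seg, Set.projIcc_of_mem zero_le_one ht]

open Classical in
theorem seg_coord (d : G.Dart) {t : ℝ} (ht : t ∈ Set.Icc (0 : ℝ) 1) (w : V) :
    (seg d t).coord w = (if w = d.fst then 1 - t else 0) + (if w = d.snd then t else 0) := by
  rw [seg_eq_onEdge d ht]; simp [Point.onEdge]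

theorem seg_coord_fst (d : G.Dart) {t : ℝ} (ht : t ∈ Set.Icc (0 : ℝ) 1) :
    (seg d t).coord d.fst = 1 - t := by
  simp [seg_coord d ht, d.fst_ne_snd]

theorem seg_coord_snd (d : G.Dart) {t : ℝ} (ht : t ∈ Set.Icc (0 : ℝ) 1) :
    (seg d t).coord d.snd = t := by
  simp [seg_coord d ht, d.fst_ne_snd.symm]

/-- The point `x` lies on the closed edge `d`. -/
def OnDart (d : G.Dart) (x : Point G) : Prop := ∀ w, x.coord w ≠ 0 → w = d.fst ∨ w = d.snd

theorem onDart_seg (d : G.Dart) (t : ℝ) : OnDart d (seg d t) := by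
  intro w hw
  by_contra! h
  exact hw (by simp [seg, Point.onEdge, h.1, h.2])

theorem OnDart.sameSimplex {d : G.Dart} {x y : Point G} (hx : OnDart d x) (hy : OnDart d y) :
    SameSimplex x y := ⟨d.fst, d.snd, Or.inr d.adj, hx, hy⟩

theorem coord_le_one (x : Point G) (v : V) : x.coord v ≤ 1 := by
  rw [← x.sum_coord]
  exact Finset.single_le_sum (fun w _ => x.coord_nonneg w) (Finset.mem_univ v)

theorem coord_mem (x : Point G) (v : V) : x.coord v ∈ Set.Icc (0 : ℝ) 1 :=
  ⟨x.coord_nonneg v, coord_le_one x v⟩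

theorem OnDart.coord_add {d : G.Dart} {x : Point G} (hx : OnDart d x) :
    x.coord d.fst + x.coord d.snd = 1 := by
  classical
  rw [← x.sum_coord, ← Finset.sum_pair d.fst_ne_snd]
  refine Finset.sum_subset (Finset.subset_univ _) fun w _ hw => ?_
  by_contra h
  simpa using hw (by simpa using hx w h)

theorem OnDart.eq_seg {d : G.Dart} {x : Point G} (hx : OnDart d x) :
    x = seg d (x.coord d.snd) := by
  have hs := hx.coord_add
  refine Point.ext (funext fun w => ?_)
  rw [seg_coord d (coord_mem _ _)]
  by_cases h1 : w = d.fst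
  · subst h1; simp [d.fst_ne_snd]; linarith
  by_cases h2 : w = d.snd
  · subst h2; simp [d.fst_ne_snd.symm]
  · simp only [h1, h2, if_false, add_zero]
    by_contra h
    exact (hx w h).elim h1 h2

theorem eq_vertex_of_support {x : Point G} {v : V} (hx : ∀ w, x.coord w ≠ 0 → w = v) :
    x = vertex G v := by
  classical
  refine Point.ext (funext fun w => ?_)
  have h0 : ∀ w, w ≠ v → x.coord w = 0 := fun w hw => by
    by_contra h; exact hw (hx w h)
  have h1 : x.coord v = 1 := by
    rw [← x.sum_coord]
    exact (Finset.sum_eq_single v (fun w _ hw => h0 w hw) (by simp)).symm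
  rw [vertex_coord]
  split_ifs with h
  · rw [h, h1]
  · exact h0 w h

theorem eq_vertex_or_seg (x : Point G) :
    (∃ v, x = vertex G v) ∨ ∃ (d : G.Dart), ∃ t ∈ Set.Icc (0 : ℝ) 1, x = seg d t := by
  obtain ⟨u, v, huv, hx⟩ := x.mem_simplex
  rcases huv with rfl | huv
  · exact Or.inl ⟨u, eq_vertex_of_support fun w hw => (hx w hw).elim id id⟩
  · exact Or.inr ⟨⟨(u, v), huv⟩, _, coord_mem x v, OnDart.eq_seg (d := ⟨(u, v), huv⟩) hx⟩

theorem onDart_vertex_fst (d : G.Dart) : OnDart d (vertex G d.fst) := by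
  intro w hw
  by_contra! h
  exact hw (by simp [vertex_coord, h.1])

theorem onDart_vertex_snd (d : G.Dart) : OnDart d (vertex G d.snd) := by
  intro w hw
  by_contra! h
  exact hw (by simp [vertex_coord, h.2])

theorem seg_zero (d : G.Dart) : seg d 0 = vertex G d.fst := by
  rw [(onDart_vertex_fst d).eq_seg, vertex_coord, if_neg d.fst_ne_snd.symm]

theorem seg_one (d : G.Dart) : seg d 1 = vertex G d.snd := by
  rw [(onDart_vertex_snd d).eq_seg, vertex_coord, if_pos rfl]

theorem seg_symm (d : G.Dart) {t : ℝ} (ht : t ∈ Set.Icc (0 : ℝ) 1) :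
    seg d.symm t = seg d (1 - t) := by
  have h : OnDart d (seg d.symm t) := fun w hw => (onDart_seg d.symm t w hw).symm
  rw [h.eq_seg]
  congr 1
  exact seg_coord_fst d.symm ht

/-! ### Distances -/

theorem edist_le_of_chain {x y : Point G} {l : ℝ≥0∞} (h : Chain x y l) : edist x y ≤ l :=
  iInf₂_le l h

theorem le_edist {x y : Point G} {r : ℝ≥0∞} (h : ∀ l, Chain x y l → r ≤ l) : r ≤ edist x y :=
  le_iInf₂ h

theorem edist_coord_le (x y : Point G) : edist x.coord y.coord ≤ edist x y :=
  le_edist fun _ h => h.edist_le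

theorem SameSimplex.edist_eq {x y : Point G} (h : SameSimplex x y) :
    edist x y = edist x.coord y.coord :=
  le_antisymm (by simpa using edist_le_of_chain (Chain.cons h (Chain.nil y))) (edist_coord_le x y)

theorem dist_seg_coord (d : G.Dart) {s t : ℝ} (hs : s ∈ Set.Icc (0 : ℝ) 1)
    (ht : t ∈ Set.Icc (0 : ℝ) 1) : dist (seg d s).coord (seg d t).coord = |s - t| := by
  refine le_antisymm ((dist_pi_le_iff (abs_nonneg _)).2 fun w => ?_) ?_
  · rw [seg_coord d hs, seg_coord d ht, Real.dist_eq]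
    by_cases h1 : w = d.fst
    · subst h1
      simp only [d.fst_ne_snd, if_true, if_false, add_zero]
      rw [abs_sub_comm s t]; apply le_of_eq; congr 1; ring
    by_cases h2 : w = d.snd
    · simp [h2, d.fst_ne_snd.symm]
    · simp [h1, h2]
  · refine le_trans (le_of_eq ?_) (dist_le_pi_dist _ _ d.snd)
    rw [seg_coord_snd d hs, seg_coord_snd d ht, Real.dist_eq]

theorem edist_seg_seg (d : G.Dart) {s t : ℝ} (hs : s ∈ Set.Icc (0 : ℝ) 1)
    (ht : t ∈ Set.Icc (0 : ℝ) 1) : edist (seg d s) (seg d t) = ENNReal.ofReal |s - t| := by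
  rw [((onDart_seg d s).sameSimplex (onDart_seg d t)).edist_eq, edist_dist, dist_seg_coord d hs ht]

theorem edist_vertex_fst_seg (d : G.Dart) {t : ℝ} (ht : t ∈ Set.Icc (0 : ℝ) 1) :
    edist (vertex G d.fst) (seg d t) = ENNReal.ofReal t := by
  rw [← seg_zero, edist_seg_seg d (by simp) ht]; simp [abs_of_nonneg ht.1]

theorem edist_vertex_snd_seg (d : G.Dart) {t : ℝ} (ht : t ∈ Set.Icc (0 : ℝ) 1) :
    edist (vertex G d.snd) (seg d t) = ENNReal.ofReal (1 - t) := by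
  rw [← seg_one, edist_seg_seg d (by simp) ht, abs_of_nonneg (by linarith [ht.2])]

theorem edist_vertex_of_adj {u v : V} (h : G.Adj u v) : edist (vertex G u) (vertex G v) = 1 := by
  have := edist_vertex_fst_seg (G := G) ⟨(u, v), h⟩ (t := 1) (by simp)
  rwa [seg_one, ENNReal.ofReal_one] at this

theorem edist_vertex_le_length {u v : V} (p : G.Walk u v) :
    edist (vertex G u) (vertex G v) ≤ p.length := by
  induction p with
  | nil => simp
  | @cons u v w h p ih =>
    refine (edist_triangle _ (vertex G v) _).trans ?_
    rw [edist_vertex_of_adj h, SimpleGraph.Walk.length_cons, Nat.cast_add, Nat.cast_one, add_comm]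
    exact add_le_add ih le_rfl

/-- The combinatorial distance to a vertex, extended affinely to the edges. -/
def affineDist (u : V) (x : Point G) : ℝ := ∑ w, x.coord w * G.dist u w

theorem affineDist_vertex (u v : V) : affineDist u (vertex G v) = G.dist u v := by
  classical
  simp [affineDist, vertex_coord]

theorem OnDart.affineDist_eq (u : V) {d : G.Dart} {x : Point G} (hx : OnDart d x) :
    affineDist u x = G.dist u d.fst + x.coord d.snd * ((G.dist u d.snd : ℝ) - G.dist u d.fst) := by
  classical
  have : affineDist u x = x.coord d.fst * G.dist u d.fst + x.coord d.snd * G.dist u d.snd := by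
    rw [affineDist, ← Finset.sum_pair (f := fun w => x.coord w * (G.dist u w : ℝ)) d.fst_ne_snd]
    refine (Finset.sum_subset (Finset.subset_univ _) fun w _ hw => ?_).symm
    have : x.coord w = 0 := by
      by_contra h
      exact hw (by simpa using hx w h)
    simp [this]
  rw [this, eq_sub_of_add_eq hx.coord_add]
  ring

/-- On an edge the function is affine with slope at most 1 in absolute value, because the
combinatorial distances of adjacent vertices differ by at most 1. This gives the lower bound for the
length of paths between vertices. -/
theorem affineDist_le (hG : G.Connected) (u : V) {x y : Point G} {l : ℝ≥0∞} (h : Chain x y l) :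
    ENNReal.ofReal (affineDist u y - affineDist u x) ≤ l := by
  induction h with
  | nil x => simp
  | @cons x y z l h c ih =>
    have key : ENNReal.ofReal (affineDist u y - affineDist u x) ≤ edist x.coord y.coord := by
      obtain ⟨a, b, hab, hx, hy⟩ := h
      rcases hab with rfl | hab
      · rw [eq_vertex_of_support fun w hw => (hx w hw).elim id id,
          eq_vertex_of_support fun w hw => (hy w hw).elim id id]
        simp
      · have hx' : OnDart ⟨(a, b), hab⟩ x := hx
        have hy' : OnDart ⟨(a, b), hab⟩ y := hy
        rw [edist_dist]
        refine ENNReal.ofReal_le_ofReal (le_trans ?_ (dist_le_pi_dist _ _ b))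
        rw [hx'.affineDist_eq, hy'.affineDist_eq, Real.dist_eq]
        have h1 : (G.dist u b : ℝ) ≤ G.dist u a + 1 := by
          have := hG.dist_triangle (u := u) (v := a) (w := b)
          rw [SimpleGraph.dist_eq_one_iff_adj.2 hab] at this
          exact_mod_cast this
        have h2 : (G.dist u a : ℝ) ≤ G.dist u b + 1 := by
          have := hG.dist_triangle (u := u) (v := b) (w := a)
          rw [SimpleGraph.dist_eq_one_iff_adj.2 hab.symm] at this
          exact_mod_cast this
        have h3 : |(G.dist u b : ℝ) - G.dist u a| ≤ 1 := abs_le.2 ⟨by linarith, by linarith⟩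
        calc _ = (y.coord b - x.coord b) * ((G.dist u b : ℝ) - G.dist u a) := by ring
          _ ≤ |(y.coord b - x.coord b) * ((G.dist u b : ℝ) - G.dist u a)| := le_abs_self _
          _ ≤ |y.coord b - x.coord b| * 1 := by
            rw [abs_mul]; exact mul_le_mul_of_nonneg_left h3 (abs_nonneg _)
          _ = _ := by rw [mul_one, abs_sub_comm]
    calc _ = ENNReal.ofReal ((affineDist u y - affineDist u x) +
          (affineDist u z - affineDist u y)) := by congr 1; ring
      _ ≤ _ := ENNReal.ofReal_add_le.trans (add_le_add key ih)

theorem edist_vertex_vertex (hG : G.Connected) (u v : V) :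
    edist (vertex G u) (vertex G v) = (G.dist u v : ℝ≥0∞) := by
  refine le_antisymm ?_ (le_edist fun l h => ?_)
  · obtain ⟨p, hp⟩ := hG.exists_walk_length_eq_dist u v
    rw [← hp]
    exact edist_vertex_le_length p
  · have := affineDist_le hG u h
    rw [affineDist_vertex, affineDist_vertex, SimpleGraph.dist_self, Nat.cast_zero, sub_zero,
      ENNReal.ofReal_natCast] at this
    exact this

/-- If both ends of `d` were in the support of `y`, the simplex shared with `x` would be `d` itself.
-/
theorem eq_vertex_of_onDart_of_not_onDart {d : G.Dart} {x y : Point G} (h : SameSimplex x y)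
    (hx : ¬OnDart d x) (hy : OnDart d y) : y = vertex G d.fst ∨ y = vertex G d.snd := by
  obtain ⟨u, v, -, hxu, hyu⟩ := h
  by_contra! hne
  have h1 : ∃ w, y.coord w ≠ 0 ∧ w ≠ d.fst := by
    by_contra! h
    exact hne.1 (eq_vertex_of_support h)
  have h2 : ∃ w, y.coord w ≠ 0 ∧ w ≠ d.snd := by
    by_contra! h
    exact hne.2 (eq_vertex_of_support h)
  obtain ⟨w1, hw1, hw1'⟩ := h1
  obtain ⟨w2, hw2, hw2'⟩ := h2
  have e1 := (hy w1 hw1).resolve_left hw1'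
  have e2 := (hy w2 hw2).resolve_right hw2'
  subst e1 e2
  refine hx fun w hw => ?_
  have := d.fst_ne_snd
  rcases hxu w hw with rfl | rfl <;> rcases hyu _ hw1 with e | e <;>
    rcases hyu _ hw2 with e' | e' <;> simp_all

/-- A path to a point of an edge from a point outside enters the edge through one of its ends. -/
theorem edist_seg_of_not_onDart {d : G.Dart} {x : Point G} (hx : ¬OnDart d x) {s : ℝ}
    (hs : s ∈ Set.Icc (0 : ℝ) 1) :
    edist x (seg d s) = min (edist x (vertex G d.fst) + ENNReal.ofReal s)
      (edist x (vertex G d.snd) + ENNReal.ofReal (1 - s)) := by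
  refine le_antisymm (le_min ?_ ?_) (le_edist fun l h => ?_)
  · exact (edist_triangle _ _ _).trans (by rw [edist_vertex_fst_seg d hs])
  · exact (edist_triangle _ _ _).trans (by rw [edist_vertex_snd_seg d hs])
  -- The induction must also allow chains that start on the edge. For those it records only a length
  -- bound, which becomes the cost from the entry vertex once a step from outside is prepended.
  · have key : ∀ {x z l}, Chain x z l → z = seg d s →
        (OnDart d x ∧ edist x z ≤ l) ∨ edist x (vertex G d.fst) + ENNReal.ofReal s ≤ l ∨
          edist x (vertex G d.snd) + ENNReal.ofReal (1 - s) ≤ l := by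
      intro x z l h hz
      induction h with
      | nil x => exact Or.inl ⟨hz ▸ onDart_seg d s, by simp⟩
      | @cons x y z l h c ih =>
        rw [← h.edist_eq]
        by_cases hxd : OnDart d x
        · refine Or.inl ⟨hxd, (edist_triangle _ y _).trans (add_le_add le_rfl ?_)⟩
          exact edist_le_of_chain c
        refine Or.inr ?_
        rcases ih hz with ⟨hy, hl⟩ | hl | hl
        · subst hz
          rcases eq_vertex_of_onDart_of_not_onDart h hxd hy with rfl | rfl
          · rw [edist_vertex_fst_seg d hs] at hl
            exact Or.inl (add_le_add le_rfl hl)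
          · rw [edist_vertex_snd_seg d hs] at hl
            exact Or.inr (add_le_add le_rfl hl)
        · refine Or.inl (le_trans ?_ (add_le_add le_rfl hl))
          rw [← add_assoc]
          exact add_le_add (edist_triangle _ _ _) le_rfl
        · refine Or.inr (le_trans ?_ (add_le_add le_rfl hl))
          rw [← add_assoc]
          exact add_le_add (edist_triangle _ _ _) le_rfl
    rcases key h rfl with ⟨h, -⟩ | h | h
    · exact absurd h hx
    · exact min_le_of_left_le h
    · exact min_le_of_right_le h

theorem onDart_vertex_iff {d : G.Dart} {v : V} :
    OnDart d (vertex G v) ↔ v = d.fst ∨ v = d.snd := by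
  constructor
  · intro h
    exact h v (by simp [vertex_coord])
  · rintro (rfl | rfl)
    exacts [onDart_vertex_fst d, onDart_vertex_snd d]

theorem edist_vertex_seg (hG : G.Connected) (w : V) (d : G.Dart) {t : ℝ}
    (ht : t ∈ Set.Icc (0 : ℝ) 1) :
    edist (vertex G w) (seg d t) =
      ENNReal.ofReal (min (G.dist w d.fst + t) (G.dist w d.snd + (1 - t))) := by
  have h0 := ht.1
  have h1 := ht.2
  by_cases h : OnDart d (vertex G w)
  · rcases onDart_vertex_iff.1 h with rfl | rfl
    · rw [edist_vertex_fst_seg d ht, SimpleGraph.dist_self,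
        SimpleGraph.dist_eq_one_iff_adj.2 d.adj, min_eq_left] <;> push_cast <;> [congr 1; skip] <;>
        linarith
    · rw [edist_vertex_snd_seg d ht, SimpleGraph.dist_self,
        SimpleGraph.dist_eq_one_iff_adj.2 d.adj.symm, min_eq_right] <;> push_cast <;>
        [congr 1; skip] <;> linarith
  · rw [edist_seg_of_not_onDart h ht, edist_vertex_vertex hG, edist_vertex_vertex hG,
      ENNReal.ofReal_min, ENNReal.ofReal_add (Nat.cast_nonneg _) h0,
      ENNReal.ofReal_add (Nat.cast_nonneg _) (by linarith), ENNReal.ofReal_natCast,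
      ENNReal.ofReal_natCast]

theorem edist_seg_seg_of_not_onDart (hG : G.Connected) {d d' : G.Dart} {t s : ℝ}
    (ht : t ∈ Set.Icc (0 : ℝ) 1) (hs : s ∈ Set.Icc (0 : ℝ) 1) (h : ¬OnDart d' (seg d t)) :
    edist (seg d t) (seg d' s) = ENNReal.ofReal
      (min (min (G.dist d'.fst d.fst + t) (G.dist d'.fst d.snd + (1 - t)) + s)
        (min (G.dist d'.snd d.fst + t) (G.dist d'.snd d.snd + (1 - t)) + (1 - s))) := by
  have h0 := ht.1
  have h1 := ht.2
  have h2 := hs.1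
  have h3 := hs.2
  have hn : ∀ a b, (0 : ℝ) ≤ min (G.dist a d.fst + t) (G.dist b d.snd + (1 - t)) := fun a b =>
    le_min (by positivity) (add_nonneg (by positivity) (by linarith))
  rw [edist_seg_of_not_onDart h hs, edist_comm, edist_vertex_seg hG _ _ ht, edist_comm,
    edist_vertex_seg hG _ _ ht, ENNReal.ofReal_min (min _ _ + s), ENNReal.ofReal_add (hn _ _) h2,
    ENNReal.ofReal_add (hn _ _) (by linarith)]

end

section

variable {V : Type*} [Fintype V] {G : SimpleGraph V}

/-! ### Topology of a metric graph -/

theorem continuous_seg (d : G.Dart) : Continuous (seg d) := by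
  have h : Isometry fun t : Set.Icc (0 : ℝ) 1 => seg d (t : ℝ) := fun s t => by
    rw [edist_seg_seg d s.2 t.2, Subtype.edist_eq, edist_dist, Real.dist_eq]
  have h2 : seg d = (fun t : Set.Icc (0 : ℝ) 1 => seg d (t : ℝ)) ∘
      Set.projIcc 0 1 zero_le_one := by
    funext t
    simp [seg]
  rw [h2]
  exact h.continuous.comp continuous_projIcc

theorem continuous_coord : Continuous (Point.coord : Point G → V → ℝ) :=
  LipschitzWith.continuous (K := 1) fun x y => by simpa using edist_coord_le x y

theorem seg_injOn (d : G.Dart) : Set.InjOn (seg d) (Set.Icc 0 1) := fun s hs t ht h => by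
  rw [← seg_coord_snd d hs, h, seg_coord_snd d ht]

theorem univ_eq_vertices_union_segs : (Set.univ : Set (Point G)) =
    Set.range (vertex G) ∪ ⋃ d : G.Dart, seg d '' Set.Icc 0 1 := by
  refine (Set.eq_univ_of_forall fun x => ?_).symm
  rcases eq_vertex_or_seg x with ⟨v, rfl⟩ | ⟨d, t, ht, rfl⟩
  · exact Or.inl ⟨v, rfl⟩
  · exact Or.inr (Set.mem_iUnion.2 ⟨d, t, ht, rfl⟩)

instance finite_dart : Finite G.Dart :=
  Finite.of_injective (fun d : G.Dart => d.toProd) fun _ _ h => SimpleGraph.Dart.ext _ _ h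

instance compactSpace_point : CompactSpace (Point G) where
  isCompact_univ := by
    rw [univ_eq_vertices_union_segs]
    exact (Set.finite_range _).isCompact.union
      (isCompact_iUnion fun d => isCompact_Icc.image (continuous_seg d))

/-! ### Continuity of the projection -/

theorem SameSimplex.exists_between {x y : Point G} (h : SameSimplex x y) {a : ℝ≥0∞}
    (ha : a < edist x y) : ∃ z, edist x z ≤ edist x y - a ∧ edist z y ≤ a := by
  obtain ⟨u, v, huv, hx, hy⟩ := h
  rcases huv with rfl | huv
  · rw [eq_vertex_of_support fun w hw => (hx w hw).elim id id,
      eq_vertex_of_support fun w hw => (hy w hw).elim id id] at ha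
    simp at ha
  · have hx' : OnDart ⟨(u, v), huv⟩ x := hx
    have hy' : OnDart ⟨(u, v), huv⟩ y := hy
    rw [hx'.eq_seg, hy'.eq_seg] at ha ⊢
    generalize (⟨(u, v), huv⟩ : G.Dart) = d at *
    have hs := coord_mem x d.snd
    have ht := coord_mem y d.snd
    generalize x.coord d.snd = s at *
    generalize y.coord d.snd = t at *
    obtain ⟨hs0, hs1⟩ := hs
    obtain ⟨ht0, ht1⟩ := ht
    rw [edist_seg_seg d ⟨hs0, hs1⟩ ⟨ht0, ht1⟩] at ha ⊢
    lift a to NNReal using ha.ne_top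
    have ha' : (a : ℝ) < |s - t| := by
      rw [← ENNReal.ofReal_coe_nnreal] at ha
      exact (ENNReal.ofReal_lt_ofReal_iff'.1 ha).1
    have ha0 : (0 : ℝ) ≤ a := a.2
    have key : ∃ r ∈ Set.Icc (0 : ℝ) 1, |s - r| = |s - t| - a ∧ |r - t| = a := by
      rcases le_total s t with h | h
      · rw [abs_of_nonpos (by linarith)] at ha' ⊢
        refine ⟨t - a, ⟨by linarith, by linarith⟩, ?_, ?_⟩
        · rw [abs_of_nonpos (by linarith)]; ring
        · rw [abs_of_nonpos (by linarith)]; ring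
      · rw [abs_of_nonneg (by linarith)] at ha' ⊢
        refine ⟨t + a, ⟨by linarith, by linarith⟩, ?_, ?_⟩
        · rw [abs_of_nonneg (by linarith)]; ring
        · rw [abs_of_nonneg (by linarith)]; ring
    obtain ⟨r, hr, h1, h2⟩ := key
    refine ⟨seg d r, ?_, ?_⟩
    · rw [edist_seg_seg d ⟨hs0, hs1⟩ hr, h1, ENNReal.ofReal_sub _ ha0, ENNReal.ofReal_coe_nnreal]
    · rw [edist_seg_seg d hr ⟨ht0, ht1⟩, h2, ENNReal.ofReal_coe_nnreal]

/-- The chain is cut at the point from which length `r` remains. Truncated subtraction covers `l ≤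
r`, where the point is `x` itself. -/
theorem Chain.exists_between {x y : Point G} {l : ℝ≥0∞} (h : Chain x y l) (r : ℝ≥0∞) :
    ∃ z, edist x z ≤ l - r ∧ edist z y ≤ r := by
  induction h with
  | nil x => exact ⟨x, by simp, by simp⟩
  | @cons x y z l h c ih =>
    rw [← h.edist_eq]
    rcases le_or_gt (edist x y + l) r with hr' | hr'
    · exact ⟨x, by simp, ((edist_triangle _ y _).trans
        (add_le_add le_rfl (edist_le_of_chain c))).trans hr'⟩
    rcases le_or_gt r l with hr | hr
    · obtain ⟨w, hw, hw'⟩ := ih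
      refine ⟨w, ?_, hw'⟩
      rw [(ENNReal.cancel_of_ne hr'.ne_top).add_tsub_assoc_of_le hr]
      exact (edist_triangle _ y _).trans (add_le_add le_rfl hw)
    · have hl : l ≠ ⊤ := hr.ne_top
      obtain ⟨w, hw, hw'⟩ := h.exists_between (a := r - l) <| by
        rwa [ENNReal.sub_lt_iff_lt_right hl hr.le]
      refine ⟨w, hw.trans ?_, ?_⟩
      · rw [tsub_le_iff_right]
        calc edist x y = edist x y + l - l := (ENNReal.add_sub_cancel_right hl).symm
          _ ≤ _ := tsub_le_tsub_add_tsub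
      · calc edist w z ≤ (r - l) + l :=
              (edist_triangle _ y _).trans (add_le_add hw' (edist_le_of_chain c))
          _ = r := tsub_add_cancel_of_le hr.le

/-- On an almost shortest chain from `z` to `y`, the point with remaining length `r` lies in the
ball about `y` and, up to `η`, within `edist x y` of `z`. -/
theorem infEDist_closedEBall_le (x y z : Point G) (r : ℝ≥0∞) (hz : z ∈ Metric.closedEBall x r) :
    Metric.infEDist z (Metric.closedEBall y r) ≤ edist x y := by
  rcases eq_or_ne r ⊤ with rfl | hr
  · have : z ∈ Metric.closedEBall y ⊤ := by simp
    rw [Metric.infEDist_zero_of_mem this]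
    exact zero_le
  refine ENNReal.le_of_forall_pos_le_add fun η hη hlt => ?_
  have hzy : edist z y < r + edist x y + η := by
    refine lt_of_le_of_lt ((edist_triangle _ x _).trans (add_le_add hz le_rfl)) ?_
    exact ENNReal.lt_add_right (ENNReal.add_ne_top.2 ⟨hr, hlt.ne⟩) (by simpa using hη.ne')
  obtain ⟨l, hl, hl'⟩ : ∃ l, Chain z y l ∧ l < r + edist x y + η := by
    have : (⨅ (l : ℝ≥0∞) (_ : Chain z y l), l) < r + edist x y + η := hzy
    simpa only [iInf_lt_iff, exists_prop] using this
  obtain ⟨w, hw, hw'⟩ := hl.exists_between r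
  refine (Metric.infEDist_le_edist_of_mem (y := w) hw').trans (hw.trans ?_)
  rw [tsub_le_iff_left, ← add_assoc]
  exact hl'.le

theorem continuous_ballMap (ε : ℝ) : Continuous (ballMap G ε) := by
  refine LipschitzWith.continuous (K := 1) fun x y => ?_
  rw [TopologicalSpace.Closeds.edist_eq, ENNReal.coe_one, one_mul]
  refine Metric.hausdorffEDist_le_of_infEDist (fun z hz => ?_) fun z hz => ?_
  · exact infEDist_closedEBall_le x y z _ hz
  · rw [edist_comm]
    exact infEDist_closedEBall_le y x z _ hz

end

section

/-! ### Cells of the square of two half-edges -/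

/-- The points `(t, s)` and `(t', s')` of the square `[0, 1/2]²` are not separated by a line
`± t ± s ∈ ε + ℤ`. -/
def SameCell (ε t s t' s' : ℝ) : Prop :=
  ∀ m : ℤ, (m ≤ ε - t - s ↔ m ≤ ε - t' - s') ∧ (m ≤ ε - t + s ↔ m ≤ ε - t' + s') ∧
    (m ≤ ε + t - s ↔ m ≤ ε + t' - s') ∧ (m ≤ ε + t + s ↔ m ≤ ε + t' + s')

/-- `s` lies on the same side of `a` as `s'` does of `a'`. -/
def SameSide (a s a' s' : ℝ) : Prop := (s ≤ a ↔ s' ≤ a') ∧ (a ≤ s ↔ a' ≤ s')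

theorem sameSide_of_lt {a s a' s' : ℝ} (h : s < a) (h' : s' < a') : SameSide a s a' s' :=
  ⟨iff_of_true h.le h'.le, iff_of_false h.not_ge h'.not_ge⟩

theorem sameSide_of_gt {a s a' s' : ℝ} (h : a < s) (h' : a' < s') : SameSide a s a' s' :=
  ⟨iff_of_false h.not_ge h'.not_ge, iff_of_true h.le h'.le⟩

theorem sameSide_of_eq {a s a' s' : ℝ} (h : s = a) (h' : s' = a') : SameSide a s a' s' :=
  ⟨iff_of_true h.le h'.le, iff_of_true h.ge h'.ge⟩

/-- The levels `f ≤ g` cut `[0, 1/2]` into the same pattern as `f' ≤ g'`; `s` is `0`, `f`, the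
midpoint, `g` or `1/2` according to the place of `s'`. -/
theorem exists_sameSide {f g f' g' s' : ℝ} (hf : 0 < f) (hfg : f ≤ g) (hg : g < 1 / 2)
    (hfg' : f' ≤ g') (h : f = g ↔ f' = g') :
    ∃ s, 0 ≤ s ∧ s ≤ 1 / 2 ∧ SameSide f s f' s' ∧ SameSide g s g' s' := by
  rcases lt_trichotomy s' f' with h1 | h1 | h1
  · exact ⟨0, le_rfl, by norm_num, sameSide_of_lt hf h1,
      sameSide_of_lt (hf.trans_le hfg) (h1.trans_le hfg')⟩
  · refine ⟨f, hf.le, by linarith, sameSide_of_eq rfl h1, ?_⟩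
    rcases hfg'.lt_or_eq with h2 | h2
    · exact sameSide_of_lt (hfg.lt_of_ne fun e => h2.ne (h.1 e)) (by linarith)
    · exact sameSide_of_eq (h.2 h2) (by linarith)
  rcases lt_trichotomy s' g' with h2 | h2 | h2
  · have := hfg.lt_of_ne fun e => (h1.trans h2).ne (h.1 e)
    exact ⟨(f + g) / 2, by linarith, by linarith, sameSide_of_gt (by linarith) h1,
      sameSide_of_lt (by linarith) h2⟩
  · have := hfg.lt_of_ne fun e => (h2 ▸ h1).ne (h.1 e)
    exact ⟨g, by linarith, by linarith, sameSide_of_gt this h1, sameSide_of_eq rfl h2⟩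
  · exact ⟨1 / 2, by norm_num, le_rfl, sameSide_of_gt (by linarith) h1, sameSide_of_gt hg h2⟩

/-- In each of the four positions of `t` relative to `e` and `1/2 - e`, exactly two of the four
levels lie in `(0, 1/2)` and the other two miss `[0, 1/2]`. The two inside can coincide only if `e`
is `0` or `1/2`, independently of `t`. -/
theorem exists_sameSides {e t t' s' : ℝ} (he : 0 ≤ e) (he' : e ≤ 1 / 2)
    (ht : 0 < t) (ht1 : t < 1 / 2) (ht' : 0 < t') (ht1' : t' < 1 / 2)
    (hs : 0 ≤ s') (hs1 : s' ≤ 1 / 2)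
    (h1 : t < e ∧ t' < e ∨ e < t ∧ e < t')
    (h2 : t < 1 / 2 - e ∧ t' < 1 / 2 - e ∨ 1 / 2 - e < t ∧ 1 / 2 - e < t') :
    ∃ s, 0 ≤ s ∧ s ≤ 1 / 2 ∧ SameSide (e - t) s (e - t') s' ∧ SameSide (1 - e - t) s (1 - e - t') s'
      ∧ SameSide (t - e) s (t' - e) s' ∧ SameSide (t + e) s (t' + e) s' := by
  rcases h1 with ⟨h1, h1'⟩ | ⟨h1, h1'⟩ <;> rcases h2 with ⟨h2, h2'⟩ | ⟨h2, h2'⟩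
  · obtain ⟨s, h, h', a, b⟩ := exists_sameSide (f := e - t) (g := t + e) (f' := e - t')
      (g' := t' + e) (s' := s') (by linarith) (by linarith) (by linarith) (by linarith)
      (iff_of_false (by intro h; linarith) (by intro h; linarith))
    exact ⟨s, h, h', a, sameSide_of_lt (by linarith) (by linarith),
      sameSide_of_gt (by linarith) (by linarith), b⟩
  · obtain ⟨s, h, h', a, b⟩ := exists_sameSide (f := e - t) (g := 1 - e - t) (f' := e - t')
      (g' := 1 - e - t') (s' := s') (by linarith) (by linarith) (by linarith) (by linarith)
      (by constructor <;> intro h <;> linarith)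
    exact ⟨s, h, h', a, b, sameSide_of_gt (by linarith) (by linarith),
      sameSide_of_lt (by linarith) (by linarith)⟩
  · obtain ⟨s, h, h', a, b⟩ := exists_sameSide (f := t - e) (g := t + e) (f' := t' - e)
      (g' := t' + e) (s' := s') (by linarith) (by linarith) (by linarith) (by linarith)
      (by constructor <;> intro h <;> linarith)
    exact ⟨s, h, h', sameSide_of_gt (by linarith) (by linarith),
      sameSide_of_lt (by linarith) (by linarith), a, b⟩
  · obtain ⟨s, h, h', a, b⟩ := exists_sameSide (f := t - e) (g := 1 - e - t) (f' := t' - e)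
      (g' := 1 - e - t') (s' := s') (by linarith) (by linarith) (by linarith) (by linarith)
      (iff_of_false (by intro h; linarith) (by intro h; linarith))
    exact ⟨s, h, h', sameSide_of_gt (by linarith) (by linarith), b, a,
      sameSide_of_lt (by linarith) (by linarith)⟩

/-- Here `e` is the distance from `ε` to the nearest integer: `ε₀` if `⌊2ε⌋` is even and `1/2 - ε₀`
if it is odd. Both `cut` and the family of lines are insensitive to the choice. -/
theorem exists_eq_int_add_or_sub (ε : ℝ) : ∃ (K : ℤ) (e : ℝ), 0 ≤ e ∧ e ≤ 1 / 2 ∧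
    (ε = K + e ∨ ε = K - e) ∧ cut ε = min e (1 / 2 - e) := by
  have h0 := Int.floor_le (2 * ε)
  have h1 := Int.lt_floor_add_one (2 * ε)
  rcases Int.even_or_odd' ⌊2 * ε⌋ with ⟨K, hK | hK⟩
  · refine ⟨K, ε - K, ?_, ?_, Or.inl (by ring), ?_⟩
    · rw [hK] at h0; push_cast at h0; linarith
    · rw [hK] at h1; push_cast at h1; linarith
    · rw [cut, hK]; push_cast; congr 1 <;> ring
  · refine ⟨K + 1, K + 1 - ε, ?_, ?_, Or.inr (by push_cast; ring), ?_⟩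
    · rw [hK] at h1; push_cast at h1; linarith
    · rw [hK] at h0; push_cast at h0; linarith
    · rw [cut, hK, min_comm]; push_cast; congr 1 <;> ring

/-- As `x` ranges over `[b - 1, b + 1)`, the only integer threshold it can cross is `b`. So each
family of parallel lines contributes one line to the square. -/
theorem intCast_le_iff_of_gap {x x' y y' : ℝ} {P P' : Prop} (K b m : ℤ) (hP : P ↔ P')
    (h : (b : ℝ) ≤ x ↔ P) (h' : (b : ℝ) ≤ x' ↔ P') (hy : y = K + x) (hy' : y' = K + x')
    (hx : (b : ℝ) - 1 ≤ x ∧ x < b + 1) (hx' : (b : ℝ) - 1 ≤ x' ∧ x' < b + 1) :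
    (m : ℝ) ≤ y ↔ (m : ℝ) ≤ y' := by
  subst hy hy'
  rcases lt_trichotomy m (K + b) with h1 | h1 | h1
  · have : (m : ℝ) ≤ K + b - 1 := by exact_mod_cast Int.le_sub_one_of_lt h1
    exact iff_of_true (by linarith) (by linarith)
  · have h2 : (m : ℝ) = K + b := by exact_mod_cast h1
    rw [h2, add_le_add_iff_left, add_le_add_iff_left, h, h', hP]
  · have : (K : ℝ) + b + 1 ≤ m := by exact_mod_cast h1
    exact iff_of_false (by linarith) (by linarith)

theorem sameCell_of_sameSides {ε e t s t' s' : ℝ} (K : ℤ) (hε : ε = K + e ∨ ε = K - e)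
    (he : 0 ≤ e) (he' : e ≤ 1 / 2) (ht : 0 < t) (ht1 : t < 1 / 2) (ht' : 0 < t')
    (ht1' : t' < 1 / 2) (hs : 0 ≤ s) (hs1 : s ≤ 1 / 2) (hs' : 0 ≤ s') (hs1' : s' ≤ 1 / 2)
    (hA : SameSide (e - t) s (e - t') s') (hB : SameSide (1 - e - t) s (1 - e - t') s')
    (hC : SameSide (t - e) s (t' - e) s') (hD : SameSide (t + e) s (t' + e) s') :
    SameCell ε t s t' s' := by
  intro m
  rcases hε with rfl | rfl
  -- Replacing `e` by `-e` only permutes the four lines: `A` trades places with `C` or `D` or `B`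
  -- among the sign patterns, and the threshold for `B` becomes `-1` instead of `1`.
  · exact ⟨intCast_le_iff_of_gap (x := e - t - s) (x' := e - t' - s') K (0) m hA.1
        (by push_cast; constructor <;> intro h <;> linarith)
        (by push_cast; constructor <;> intro h <;> linarith) (by ring) (by ring)
        (by push_cast; constructor <;> linarith) (by push_cast; constructor <;> linarith),
      intCast_le_iff_of_gap (x := e - t + s) (x' := e - t' + s') K (0) m hC.2
        (by push_cast; constructor <;> intro h <;> linarith)
        (by push_cast; constructor <;> intro h <;> linarith) (by ring) (by ring)
        (by push_cast; constructor <;> linarith) (by push_cast; constructor <;> linarith),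
      intCast_le_iff_of_gap (x := e + t - s) (x' := e + t' - s') K (0) m hD.1
        (by push_cast; constructor <;> intro h <;> linarith)
        (by push_cast; constructor <;> intro h <;> linarith) (by ring) (by ring)
        (by push_cast; constructor <;> linarith) (by push_cast; constructor <;> linarith),
      intCast_le_iff_of_gap (x := e + t + s) (x' := e + t' + s') K (1) m hB.2
        (by push_cast; constructor <;> intro h <;> linarith)
        (by push_cast; constructor <;> intro h <;> linarith) (by ring) (by ring)
        (by push_cast; constructor <;> linarith) (by push_cast; constructor <;> linarith)⟩
  · exact ⟨intCast_le_iff_of_gap (x := -e - t - s) (x' := -e - t' - s') K (-1) m hB.1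
        (by push_cast; constructor <;> intro h <;> linarith)
        (by push_cast; constructor <;> intro h <;> linarith) (by ring) (by ring)
        (by push_cast; constructor <;> linarith) (by push_cast; constructor <;> linarith),
      intCast_le_iff_of_gap (x := -e - t + s) (x' := -e - t' + s') K (0) m hD.2
        (by push_cast; constructor <;> intro h <;> linarith)
        (by push_cast; constructor <;> intro h <;> linarith) (by ring) (by ring)
        (by push_cast; constructor <;> linarith) (by push_cast; constructor <;> linarith),
      intCast_le_iff_of_gap (x := -e + t - s) (x' := -e + t' - s') K (0) m hC.1
        (by push_cast; constructor <;> intro h <;> linarith)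
        (by push_cast; constructor <;> intro h <;> linarith) (by ring) (by ring)
        (by push_cast; constructor <;> linarith) (by push_cast; constructor <;> linarith),
      intCast_le_iff_of_gap (x := -e + t + s) (x' := -e + t' + s') K (0) m hA.2
        (by push_cast; constructor <;> intro h <;> linarith)
        (by push_cast; constructor <;> intro h <;> linarith) (by ring) (by ring)
        (by push_cast; constructor <;> linarith) (by push_cast; constructor <;> linarith)⟩

theorem pieceInterval_subset (ε : ℝ) (j : Fin 3) : pieceInterval ε j ⊆ Set.Ioo 0 (1 / 2) := by
  obtain ⟨K, e, he, he', -, hc⟩ := exists_eq_int_add_or_sub ε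
  have h0 : 0 ≤ cut ε := hc ▸ le_min he (by linarith)
  have h1 : cut ε ≤ 1 / 4 := by
    rw [hc]
    rcases le_total e (1 / 4) with h | h
    · exact min_le_of_left_le h
    · exact min_le_of_right_le (by linarith)
  intro t ht
  fin_cases j <;> simp only [pieceInterval, Fin.isValue, Fin.zero_eta, Fin.mk_one, Fin.reduceFinMk,
    Matrix.cons_val, Matrix.cons_val_zero, Matrix.cons_val_one, Set.mem_Ioo] at ht ⊢ <;>
    constructor <;> linarith [ht.1, ht.2]

theorem exists_sameCell {ε t t' s' : ℝ} {j : Fin 3} (ht : t ∈ pieceInterval ε j)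
    (ht' : t' ∈ pieceInterval ε j) (hs' : s' ∈ Set.Icc (0 : ℝ) (1 / 2)) :
    ∃ s ∈ Set.Icc (0 : ℝ) (1 / 2), SameCell ε t s t' s' := by
  obtain ⟨K, e, he, he', hε, hc⟩ := exists_eq_int_add_or_sub ε
  obtain ⟨h0, h1⟩ := pieceInterval_subset ε j ht
  obtain ⟨h0', h1'⟩ := pieceInterval_subset ε j ht'
  -- The cut points are `e` and `1/2 - e` in some order, so a piece lies strictly on one side of
  -- each.
  have key : (t < e ∧ t' < e ∨ e < t ∧ e < t') ∧
      (t < 1 / 2 - e ∧ t' < 1 / 2 - e ∨ 1 / 2 - e < t ∧ 1 / 2 - e < t') := by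
    rcases le_total e (1 / 2 - e) with h | h <;> [rw [min_eq_left h] at hc; rw [min_eq_right h] at hc]
      <;> fin_cases j <;>
      simp only [pieceInterval, hc, Fin.isValue, Fin.zero_eta, Fin.mk_one, Fin.reduceFinMk,
        Matrix.cons_val, Matrix.cons_val_zero, Matrix.cons_val_one, Set.mem_Ioo] at ht ht' <;>
      obtain ⟨a, b⟩ := ht <;> obtain ⟨a', b'⟩ := ht' <;> constructor <;>
      first
        | exact Or.inl ⟨by linarith, by linarith⟩
        | exact Or.inr ⟨by linarith, by linarith⟩
  obtain ⟨s, hs, hs1, hA, hB, hC, hD⟩ :=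
    exists_sameSides he he' h0 h1 h0' h1' hs'.1 hs'.2 key.1 key.2
  exact ⟨s, ⟨hs, hs1⟩, sameCell_of_sameSides K hε he he' h0 h1 h0' h1' hs hs1 hs'.1 hs'.2
    hA hB hC hD⟩

end

section

variable {V : Type*} [Fintype V] {G : SimpleGraph V}

/-! ### Balls about the points of an edge -/

theorem eq_or_eq_symm_of_onDart {d d' : G.Dart} {t : ℝ} (ht : t ∈ Set.Ioo (0 : ℝ) 1)
    (h : OnDart d' (seg d t)) : d' = d ∨ d' = d.symm := by
  have ht' := Set.Ioo_subset_Icc_self ht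
  have h1 := h d.fst (by rw [seg_coord_fst d ht']; linarith [ht.2])
  have h2 := h d.snd (by rw [seg_coord_snd d ht']; linarith [ht.1])
  have hne := d.fst_ne_snd
  rcases h1 with h1 | h1
  · refine Or.inl (SimpleGraph.Dart.ext _ _ (Prod.ext h1.symm ?_))
    exact (h2.resolve_left fun e => hne (h1.trans e.symm)).symm
  · refine Or.inr (SimpleGraph.Dart.ext _ _ (Prod.ext ?_ h1.symm))
    exact (h2.resolve_right fun e => hne (h1.trans e.symm)).symm

theorem Icc_half_subset : Set.Icc (0 : ℝ) (1 / 2) ⊆ Set.Icc 0 1 :=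
  Set.Icc_subset_Icc_right (by norm_num)

theorem edist_seg_seg_symm (d : G.Dart) {t s : ℝ} (ht : t ∈ Set.Icc (0 : ℝ) 1)
    (hs : s ∈ Set.Icc (0 : ℝ) 1) :
    edist (seg d t) (seg d.symm s) = ENNReal.ofReal |t + s - 1| := by
  rw [seg_symm d hs, edist_seg_seg d ht ⟨by linarith [hs.2], by linarith [hs.1]⟩]
  congr 2; ring

/-- On different edges the distance is a minimum of four numbers `n ± t ± s` with `n` an integer,
one for each choice of ends passed through; on the same edge it is `|t - s|` or `1 - t - s`.
Comparing these with `ε` is what `SameCell` controls. -/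
theorem edist_le_iff_of_sameCell (hG : G.Connected) {ε : ℝ} (hε : 0 < ε) (d d' : G.Dart)
    {t s t' s' : ℝ} (ht : t ∈ Set.Ioo (0 : ℝ) (1 / 2)) (ht' : t' ∈ Set.Ioo (0 : ℝ) (1 / 2))
    (hs : s ∈ Set.Icc (0 : ℝ) (1 / 2)) (hs' : s' ∈ Set.Icc (0 : ℝ) (1 / 2))
    (h : SameCell ε t s t' s') :
    edist (seg d t) (seg d' s) ≤ ENNReal.ofReal ε ↔
      edist (seg d t') (seg d' s') ≤ ENNReal.ofReal ε := by
  have hti := Icc_half_subset (Set.Ioo_subset_Icc_self ht)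
  have hti' := Icc_half_subset (Set.Ioo_subset_Icc_self ht')
  have hsi := Icc_half_subset hs
  have hsi' := Icc_half_subset hs'
  have hto : t ∈ Set.Ioo (0 : ℝ) 1 := ⟨ht.1, by linarith [ht.2]⟩
  have hto' : t' ∈ Set.Ioo (0 : ℝ) 1 := ⟨ht'.1, by linarith [ht'.2]⟩
  by_cases h1 : d' = d
  · subst h1
    rw [edist_seg_seg _ hti hsi, edist_seg_seg _ hti' hsi', ENNReal.ofReal_le_ofReal_iff hε.le,
      ENNReal.ofReal_le_ofReal_iff hε.le, abs_le, abs_le]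
    have := h 0
    push_cast at this
    obtain ⟨-, a, b, -⟩ := this
    refine and_congr ⟨fun h => ?_, fun h => ?_⟩ ⟨fun h => ?_, fun h => ?_⟩
    · linarith [b.1 (by linarith)]
    · linarith [b.2 (by linarith)]
    · linarith [a.1 (by linarith)]
    · linarith [a.2 (by linarith)]
  by_cases h2 : d' = d.symm
  · subst h2
    rw [edist_seg_seg_symm _ hti hsi, edist_seg_seg_symm _ hti' hsi',
      ENNReal.ofReal_le_ofReal_iff hε.le,
      ENNReal.ofReal_le_ofReal_iff hε.le, abs_le, abs_le]
    have := h 1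
    push_cast at this
    obtain ⟨-, -, -, b⟩ := this
    refine and_congr ⟨fun h => ?_, fun h => ?_⟩ (iff_of_true ?_ ?_)
    · linarith [b.1 (by linarith)]
    · linarith [b.2 (by linarith)]
    · linarith [ht.2, hs.2]
    · linarith [ht'.2, hs'.2]
  have h3 : ¬OnDart d' (seg d t) := fun h => (eq_or_eq_symm_of_onDart hto h).elim h1 h2
  have h3' : ¬OnDart d' (seg d t') := fun h => (eq_or_eq_symm_of_onDart hto' h).elim h1 h2
  rw [edist_seg_seg_of_not_onDart hG hti hsi h3, edist_seg_seg_of_not_onDart hG hti' hsi' h3',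
    ENNReal.ofReal_le_ofReal_iff hε.le, ENNReal.ofReal_le_ofReal_iff hε.le]
  simp only [← min_add_add_right, min_le_iff]
  refine or_congr (or_congr ?_ ?_) (or_congr ?_ ?_)
  · have := (h (G.dist d'.fst d.fst)).1
    push_cast at this
    constructor <;> intro h
    · linarith [this.1 (by linarith)]
    · linarith [this.2 (by linarith)]
  · have := (h (G.dist d'.fst d.snd + 1)).2.2.1
    push_cast at this
    constructor <;> intro h
    · linarith [this.1 (by linarith)]
    · linarith [this.2 (by linarith)]
  · have := (h (G.dist d'.snd d.fst + 1)).2.1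
    push_cast at this
    constructor <;> intro h
    · linarith [this.1 (by linarith)]
    · linarith [this.2 (by linarith)]
  · have := (h (G.dist d'.snd d.snd + 2)).2.2.2
    push_cast at this
    constructor <;> intro h
    · linarith [this.1 (by linarith)]
    · linarith [this.2 (by linarith)]

theorem exists_dart_fst {V : Type*} {G : SimpleGraph V} (hG : G.Connected) (d : G.Dart) (v : V) :
    ∃ d' : G.Dart, d'.fst = v := by
  have : Nontrivial V := ⟨⟨d.fst, d.snd, d.fst_ne_snd⟩⟩
  obtain ⟨w, hw⟩ := hG.preconnected.exists_adj_of_nontrivial v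
  exact ⟨⟨(v, w), hw⟩, rfl⟩

/-- The dart `d` only witnesses that the graph has an edge; a single vertex lies on no half-edge. -/
theorem exists_half_seg (hG : G.Connected) (d : G.Dart) (x : Point G) :
    ∃ d' : G.Dart, ∃ s ∈ Set.Icc (0 : ℝ) (1 / 2), x = seg d' s := by
  rcases eq_vertex_or_seg x with ⟨v, rfl⟩ | ⟨d', t, ht, rfl⟩
  · obtain ⟨d', rfl⟩ := exists_dart_fst hG d v
    exact ⟨d', 0, by simp, (seg_zero d').symm⟩
  · rcases le_total t (1 / 2) with h | h
    · exact ⟨d', t, ⟨ht.1, h⟩, rfl⟩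
    · refine ⟨d'.symm, 1 - t, ⟨by linarith [ht.2], by linarith⟩, ?_⟩
      rw [seg_symm d' ⟨by linarith [ht.2], by linarith [ht.1]⟩, sub_sub_cancel]

theorem closedEBall_seg_eq_univ (hG : G.Connected) {ε : ℝ} (hε : 0 < ε) {j : Fin 3}
    {d : G.Dart} {t t' : ℝ} (ht : t ∈ pieceInterval ε j) (ht' : t' ∈ pieceInterval ε j)
    (h : Metric.closedEBall (seg d t) (ENNReal.ofReal ε) = Set.univ) :
    Metric.closedEBall (seg d t') (ENNReal.ofReal ε) = Set.univ := by
  refine Set.eq_univ_of_forall fun z => ?_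
  obtain ⟨d', s', hs', rfl⟩ := exists_half_seg hG d z
  obtain ⟨s, hs, hc⟩ := exists_sameCell ht ht' hs'
  have hz : seg d' s ∈ Metric.closedEBall (seg d t) (ENNReal.ofReal ε) := h ▸ Set.mem_univ _
  rw [Metric.mem_closedEBall'] at hz ⊢
  exact (edist_le_iff_of_sameCell hG hε d d' (pieceInterval_subset ε j ht)
    (pieceInterval_subset ε j ht') hs hs' hc).1 hz

theorem closedEBall_seg_congr (hG : G.Connected) {ε : ℝ} (hε : 0 < ε) {j : Fin 3}
    {d₁ d₂ : G.Dart} {t t' : ℝ} (ht : t ∈ pieceInterval ε j) (ht' : t' ∈ pieceInterval ε j)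
    (h : Metric.closedEBall (seg d₁ t) (ENNReal.ofReal ε) =
      Metric.closedEBall (seg d₂ t) (ENNReal.ofReal ε)) :
    Metric.closedEBall (seg d₁ t') (ENNReal.ofReal ε) =
      Metric.closedEBall (seg d₂ t') (ENNReal.ofReal ε) := by
  ext z
  obtain ⟨d', s', hs', rfl⟩ := exists_half_seg hG d₁ z
  obtain ⟨s, hs, hc⟩ := exists_sameCell ht ht' hs'
  have hz := Set.ext_iff.1 h (seg d' s)
  have hh := pieceInterval_subset ε j ht
  have hh' := pieceInterval_subset ε j ht'
  rw [Metric.mem_closedEBall', Metric.mem_closedEBall'] at hz ⊢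
  rwa [edist_le_iff_of_sameCell hG hε d₁ d' hh hh' hs hs' hc,
    edist_le_iff_of_sameCell hG hε d₂ d' hh hh' hs hs' hc] at hz

/-! ### The frontier of a ball determines the distance of its center to the vertices -/

/-- By connectedness some edge meets both `B` and its complement. Oriented from a point of `B` to
one outside, it has a last parameter `a` in `B` before the outside point `b`. -/
theorem exists_frontier_seg (hG : G.Connected) (d : G.Dart) {B : Set (Point G)} (hB : IsClosed B)
    (hne : B.Nonempty) (hu : B ≠ Set.univ) :
    ∃ (d' : G.Dart) (a b : ℝ), 0 ≤ a ∧ a < b ∧ b ≤ 1 ∧ seg d' a ∈ B ∧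
      ∀ s ∈ Set.Ioc a b, seg d' s ∉ B := by
  have mixed : ∃ (d' : G.Dart) (s r : ℝ), s ∈ Set.Icc (0 : ℝ) 1 ∧ r ∈ Set.Icc (0 : ℝ) 1 ∧
      seg d' s ∈ B ∧ seg d' r ∉ B := by
    by_contra! H
    obtain ⟨x, hx⟩ := hne
    obtain ⟨d₀, s₀, hs₀, rfl⟩ := exists_half_seg hG d x
    have hv : ∀ u v, G.Walk u v → vertex G u ∈ B → vertex G v ∈ B := by
      intro u v p hp
      induction p with
      | nil => exact hp
      | @cons u v w h p ih =>
        refine ih ?_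
        rw [← seg_zero ⟨(u, v), h⟩] at hp
        have := H _ 0 1 (by simp) (by simp) hp
        rwa [seg_one] at this
    have h0 : vertex G d₀.fst ∈ B := by
      rw [← seg_zero]
      exact H _ _ _ (Icc_half_subset hs₀) (by simp) hx
    refine hu (Set.eq_univ_of_forall fun y => ?_)
    obtain ⟨d₁, s₁, hs₁, rfl⟩ := exists_half_seg hG d y
    obtain ⟨p⟩ := hG.preconnected d₀.fst d₁.fst
    have := hv _ _ p h0
    rw [← seg_zero] at this
    exact H _ _ _ (by simp) (Icc_half_subset hs₁) this
  have lt : ∃ (d' : G.Dart) (s r : ℝ), 0 ≤ s ∧ s < r ∧ r ≤ 1 ∧ seg d' s ∈ B ∧ seg d' r ∉ B := by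
    obtain ⟨d', s, r, hs, hr, h1, h2⟩ := mixed
    rcases lt_trichotomy s r with h | rfl | h
    · exact ⟨d', s, r, hs.1, h, hr.2, h1, h2⟩
    · exact absurd h1 h2
    · refine ⟨d'.symm, 1 - s, 1 - r, by linarith [hs.2], by linarith, by linarith [hr.1], ?_, ?_⟩
      · rwa [seg_symm d' ⟨by linarith [hs.2], by linarith [hs.1]⟩, sub_sub_cancel]
      · rwa [seg_symm d' ⟨by linarith [hr.2], by linarith [hr.1]⟩, sub_sub_cancel]
  obtain ⟨d', s, r, h0, hsr, h1, hs, hr⟩ := lt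
  have hc : IsCompact (Set.Icc s r ∩ seg d' ⁻¹' B) :=
    isCompact_Icc.inter_right (hB.preimage (continuous_seg d'))
  obtain ⟨a, ⟨ha, haB⟩, hmax⟩ := hc.exists_isGreatest ⟨s, ⟨le_rfl, hsr.le⟩, hs⟩
  refine ⟨d', a, r, h0.trans ha.1, ha.2.lt_of_ne ?_, h1, haB, fun x hx hxB => ?_⟩
  · rintro rfl; exact hr haB
  · exact absurd (hmax ⟨⟨ha.1.trans hx.1.le, hx.2⟩, hxB⟩) hx.1.not_ge

theorem exists_eq_seg_of_onDart {d d' : G.Dart} {t : ℝ} (ht : t ∈ Set.Icc (0 : ℝ) 1)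
    (h : OnDart d' (seg d t)) : ∃ s ∈ Set.Icc (0 : ℝ) 1, seg d t = seg d' s ∧
      ∃ m : ℤ, s = t + m ∨ s = -t + m := by
  refine ⟨_, coord_mem _ _, h.eq_seg, ?_⟩
  have hsum := h.coord_add
  rw [seg_coord d ht, seg_coord d ht] at hsum
  rw [seg_coord d ht]
  have hne := d.fst_ne_snd
  by_cases h1 : d'.snd = d.fst
  · exact ⟨1, Or.inr (by simp [h1, hne]; ring)⟩
  by_cases h2 : d'.snd = d.snd
  · exact ⟨0, Or.inl (by simp [h2, hne.symm])⟩
  by_cases h3 : d'.fst = d.fst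
  · simp only [h1, h2, h3, hne, if_true, if_false] at hsum ⊢
    exact ⟨0, Or.inl (by push_cast; linarith)⟩
  by_cases h4 : d'.fst = d.snd
  · simp only [h1, h2, h4, hne.symm, if_true, if_false] at hsum ⊢
    exact ⟨-1, Or.inl (by push_cast; linarith)⟩
  · simp [h1, h2, h3, h4] at hsum

theorem eq_of_isLast_le {f : ℝ → ℝ} {a b A ε : ℝ} (hab : a < b) (ha : A + a ≤ ε)
    (h : ∀ s ∈ Set.Ioc a b, A + s ≤ ε → f s ≤ ε) (hf : ∀ s ∈ Set.Ioc a b, ¬ f s ≤ ε) :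
    A + a = ε := by
  by_contra hne
  have h1 : a < ε - A := by
    have := lt_of_le_of_ne ha hne
    linarith
  have h2 : min b (ε - A) ∈ Set.Ioc a b := ⟨lt_min hab h1, min_le_left _ _⟩
  exact hf _ h2 (h _ h2 (by linarith [min_le_right b (ε - A)]))

/-- Leaving the ball at `a` in the direction of `b`, the distance equals `ε` exactly; along an edge
that distance is an integer plus `a ± t`. -/
theorem exists_int_of_frontier (hG : G.Connected) {ε : ℝ} (hε : 0 < ε) (d d' : G.Dart)
    {t a b : ℝ} (ht : t ∈ Set.Icc (0 : ℝ) 1) (ha : 0 ≤ a) (hab : a < b) (hb : b ≤ 1)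
    (haB : seg d' a ∈ Metric.closedEBall (seg d t) (ENNReal.ofReal ε))
    (hB : ∀ s ∈ Set.Ioc a b, seg d' s ∉ Metric.closedEBall (seg d t) (ENNReal.ofReal ε)) :
    ∃ m : ℤ, ε = a + t + m ∨ ε = a - t + m := by
  have hs : ∀ s ∈ Set.Ioc a b, s ∈ Set.Icc (0 : ℝ) 1 := fun s hs =>
    ⟨ha.trans hs.1.le, hs.2.trans hb⟩
  have ha' : a ∈ Set.Icc (0 : ℝ) 1 := ⟨ha, by linarith⟩
  simp only [Metric.mem_closedEBall'] at haB hB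
  by_cases h : OnDart d' (seg d t)
  · obtain ⟨r, hr, heq, m, hm⟩ := exists_eq_seg_of_onDart ht h
    rw [heq] at haB hB
    rw [edist_seg_seg d' hr ha', ENNReal.ofReal_le_ofReal_iff hε.le, abs_le] at haB
    have hB' : ∀ s ∈ Set.Ioc a b, ¬ |r - s| ≤ ε := fun s hs' hle => hB s hs' <| by
      rwa [edist_seg_seg d' hr (hs s hs'), ENNReal.ofReal_le_ofReal_iff hε.le]
    have := eq_of_isLast_le (A := -r) hab (by linarith [haB.1])
      (fun s hs' hle => abs_le.2 ⟨by linarith, by linarith [hs'.1]⟩) hB'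
    rcases hm with hm | hm
    · exact ⟨-m, Or.inr (by push_cast; linarith)⟩
    · exact ⟨-m, Or.inl (by push_cast; linarith)⟩
  · rw [edist_seg_seg_of_not_onDart hG ht ha' h, ENNReal.ofReal_le_ofReal_iff hε.le] at haB
    have hB' := fun s hs' (hle : _ ≤ ε) => hB s hs' <| by
      rw [edist_seg_seg_of_not_onDart hG ht (hs s hs') h, ENNReal.ofReal_le_ofReal_iff hε.le]
      exact hle
    have h1 : min (G.dist d'.fst d.fst + t) (G.dist d'.fst d.snd + (1 - t)) + a ≤ ε := by
      rcases min_le_iff.1 haB with h1 | h1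
      · exact h1
      -- A shortest path entering through `d'.snd` would pass `b` first, putting `b` in the ball.
      · exact absurd (min_le_of_right_le (by linarith)) (hB' b ⟨hab, le_rfl⟩)
    have := eq_of_isLast_le hab h1 (fun s _ hle => min_le_of_left_le hle) hB'
    rcases min_choice (G.dist d'.fst d.fst + t) (G.dist d'.fst d.snd + (1 - t)) with h2 | h2
    · exact ⟨G.dist d'.fst d.fst, Or.inl (by rw [h2] at this; push_cast; linarith)⟩
    · exact ⟨G.dist d'.fst d.snd + 1, Or.inr (by rw [h2] at this; push_cast; linarith)⟩

theorem eq_of_int_add {t t' : ℝ} (ht : t ∈ Set.Icc (0 : ℝ) (1 / 2))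
    (ht' : t' ∈ Set.Icc (0 : ℝ) (1 / 2)) {m : ℤ} (h : t' = t + m ∨ t + t' = m) : t = t' := by
  obtain ⟨h0, h1⟩ := ht
  obtain ⟨h0', h1'⟩ := ht'
  rcases h with h | h
  · have h2 : (-1 : ℝ) < m := by linarith
    have h3 : (m : ℝ) < 1 := by linarith
    have : m = 0 := by
      have h2' : (-1 : ℤ) < m := by exact_mod_cast h2
      have h3' : m < 1 := by exact_mod_cast h3
      omega
    rw [h, this]; simp
  · have h2 : (-1 : ℝ) < m := by linarith
    have h3 : (m : ℝ) < 2 := by linarith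
    have : m = 0 ∨ m = 1 := by
      have h2' : (-1 : ℤ) < m := by exact_mod_cast h2
      have h3' : m < 2 := by exact_mod_cast h3
      omega
    rcases this with rfl | rfl <;> push_cast at h <;> linarith

/-- The same frontier coordinate `a` serves both centres, so `t ≡ ±t'` mod 1, and `[0, 1/2]` is a
fundamental domain for these symmetries. -/
theorem eq_of_closedEBall_seg_eq (hG : G.Connected) {ε : ℝ} (hε : 0 < ε) {d d' : G.Dart}
    {t t' : ℝ} (ht : t ∈ Set.Icc (0 : ℝ) (1 / 2)) (ht' : t' ∈ Set.Icc (0 : ℝ) (1 / 2))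
    (h : Metric.closedEBall (seg d t) (ENNReal.ofReal ε) =
      Metric.closedEBall (seg d' t') (ENNReal.ofReal ε))
    (hu : Metric.closedEBall (seg d t) (ENNReal.ofReal ε) ≠ Set.univ) : t = t' := by
  obtain ⟨f, a, b, ha, hab, hb, haB, hB⟩ := exists_frontier_seg hG d
    Metric.isClosed_closedEBall ⟨_, Metric.mem_closedEBall_self⟩ hu
  obtain ⟨m, hm⟩ := exists_int_of_frontier hG hε d f (Icc_half_subset ht) ha hab hb haB hB
  rw [h] at haB hB
  obtain ⟨n, hn⟩ := exists_int_of_frontier hG hε d' f (Icc_half_subset ht') ha hab hb haB hB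
  rcases hm with hm | hm <;> rcases hn with hn | hn
  · exact eq_of_int_add ht ht' (m := m - n) (Or.inl (by push_cast; linarith))
  · exact eq_of_int_add ht ht' (m := n - m) (Or.inr (by push_cast; linarith))
  · exact eq_of_int_add ht ht' (m := m - n) (Or.inr (by push_cast; linarith))
  · exact eq_of_int_add ht ht' (m := n - m) (Or.inl (by push_cast; linarith))

end

section

/-! ### Spaces glued from finitely many arcs -/

/-- The space `Y` is the disjoint union of a finite set of nodes and of the open arcs
`arc i '' (0, 1)`, where the paths `arc i` start and end at nodes. -/
structure ArcDecomposition (Y : Type*) [TopologicalSpace Y] (ι : Type*) where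
  nodes : Set Y
  finite_nodes : nodes.Finite
  nonempty_nodes : nodes.Nonempty
  arc : ι → ℝ → Y
  continuous_arc : ∀ i, Continuous (arc i)
  arc_zero : ∀ i, arc i 0 ∈ nodes
  arc_one : ∀ i, arc i 1 ∈ nodes
  arc_notMem : ∀ i, ∀ s ∈ Set.Ioo (0 : ℝ) 1, arc i s ∉ nodes
  arc_inj : ∀ i j, ∀ s ∈ Set.Ioo (0 : ℝ) 1, ∀ s' ∈ Set.Ioo (0 : ℝ) 1,
    arc i s = arc j s' → i = j ∧ s = s'
  cover : ∀ y, y ∈ nodes ∨ ∃ i, ∃ s ∈ Set.Ioo (0 : ℝ) 1, y = arc i s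

namespace ArcDecomposition

variable {Y ι : Type*} [TopologicalSpace Y] (D : ArcDecomposition Y ι)

theorem arc_inj' {i j : ι} {s s' : ℝ} (hs : s ∈ Set.Ioo (0 : ℝ) 1) (hs' : s' ∈ Set.Icc (0 : ℝ) 1)
    (h : D.arc i s = D.arc j s') : i = j ∧ s = s' := by
  rcases hs'.1.eq_or_lt with rfl | h0
  · exact absurd (h ▸ D.arc_zero j) (D.arc_notMem i s hs)
  rcases hs'.2.eq_or_lt with rfl | h1
  · exact absurd (h ▸ D.arc_one j) (D.arc_notMem i s hs)
  exact D.arc_inj i j s hs s' ⟨h0, h1⟩ h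

/-- The arcs have distinct ends, and no two arcs have the same pair of ends. -/
structure IsSimple : Prop where
  ne : ∀ i, D.arc i 0 ≠ D.arc i 1
  eq_of_ends : ∀ i j, D.arc i 0 = D.arc j 0 → D.arc i 1 = D.arc j 1 → i = j
  eq_of_ends_swap : ∀ i j, D.arc i 0 = D.arc j 1 → D.arc i 1 = D.arc j 0 → i = j

/-- Both maps are closed, from a compact to a Hausdorff space, so both targets are the quotient of
`X` by the same relation. -/
theorem nonempty_homeomorph_of_ker_eq {X Y Z : Type*} [TopologicalSpace X] [TopologicalSpace Y]
    [TopologicalSpace Z] [CompactSpace X] [T2Space Y] [T2Space Z] {f : X → Y} {g : X → Z}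
    (hf : Continuous f) (hg : Continuous g) (hfs : f.Surjective) (hgs : g.Surjective)
    (h : ∀ a b, f a = f b ↔ g a = g b) : Nonempty (Z ≃ₜ Y) := by
  have h1 : Topology.IsQuotientMap (⟨f, hf⟩ : C(X, Y)) := hf.isClosedMap.isQuotientMap hf hfs
  have h2 : Topology.IsQuotientMap (⟨g, hg⟩ : C(X, Z)) := hg.isClosedMap.isQuotientMap hg hgs
  have hk : Setoid.ker f = Setoid.ker g := Setoid.ext h
  have h3 : Quotient (Setoid.ker f) ≃ₜ Z := by
    rw [hk]; exact h2.homeomorph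
  exact ⟨h3.symm.trans h1.homeomorph⟩

theorem IsSimple.nonempty_triangulation [T2Space Y] [Finite ι] {D : ArcDecomposition Y ι}
    (hD : D.IsSimple) : Nonempty (Triangulation Y) := by
  classical
  have := D.finite_nodes.to_subtype
  obtain ⟨n, ⟨e⟩⟩ := Finite.exists_equiv_fin D.nodes
  let H : SimpleGraph (Fin n) :=
    { Adj := fun u v => ∃ i, ((e.symm u : Y) = D.arc i 0 ∧ (e.symm v : Y) = D.arc i 1) ∨
        ((e.symm u : Y) = D.arc i 1 ∧ (e.symm v : Y) = D.arc i 0)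
      symm := ⟨fun u v ⟨i, h⟩ => ⟨i, h.symm.imp And.symm And.symm⟩⟩
      loopless := ⟨fun u ⟨i, h⟩ => by
        rcases h with h | h
        · exact hD.ne i (h.1.symm.trans h.2)
        · exact hD.ne i (h.2.symm.trans h.1)⟩ }
  let d : ι → H.Dart := fun i => ⟨(e ⟨D.arc i 0, D.arc_zero i⟩, e ⟨D.arc i 1, D.arc_one i⟩),
    ⟨i, Or.inl (by simp)⟩⟩
  have hd0 : ∀ i, (e.symm (d i).fst : Y) = D.arc i 0 := fun i => by simp [d]
  have hd1 : ∀ i, (e.symm (d i).snd : Y) = D.arc i 1 := fun i => by simp [d]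
  have hdinj : ∀ i j, d i = d j ∨ d i = (d j).symm → i = j := by
    rintro i j (h | h)
    · exact hD.eq_of_ends i j (by rw [← hd0, ← hd0, h]) (by rw [← hd1, ← hd1, h])
    · exact hD.eq_of_ends_swap i j (by rw [← hd0, ← hd1, h]; rfl) (by rw [← hd1, ← hd0, h]; rfl)
  -- Both spaces are quotients of the disjoint union of the nodes and one interval per arc; it
  -- remains to match the fibres.
  let f : D.nodes ⊕ (Σ _ : ι, unitInterval) → Y :=
    Sum.elim Subtype.val fun p => D.arc p.1 (p.2 : ℝ)
  let g : D.nodes ⊕ (Σ _ : ι, unitInterval) → Point H :=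
    Sum.elim (fun w => vertex H (e w)) fun p => seg (d p.1) (p.2 : ℝ)
  have hf : Continuous f := continuous_sum_dom.2 ⟨continuous_subtype_val, continuous_sigma fun i =>
    (D.continuous_arc i).comp continuous_subtype_val⟩
  have hg : Continuous g := continuous_sum_dom.2 ⟨continuous_of_discreteTopology,
    continuous_sigma fun i => (continuous_seg (d i)).comp continuous_subtype_val⟩
  have norm : ∀ z, (∃ w : D.nodes, f z = w ∧ g z = vertex H (e w)) ∨
      ∃ i, ∃ s ∈ Set.Ioo (0 : ℝ) 1, f z = D.arc i s ∧ g z = seg (d i) s := by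
    rintro (w | ⟨i, s, hs⟩)
    · exact Or.inl ⟨w, rfl, rfl⟩
    rcases hs.1.eq_or_lt with rfl | h0
    · exact Or.inl ⟨⟨_, D.arc_zero i⟩, rfl, seg_zero (d i)⟩
    rcases hs.2.eq_or_lt with rfl | h1
    · exact Or.inl ⟨⟨_, D.arc_one i⟩, rfl, seg_one (d i)⟩
    exact Or.inr ⟨i, s, ⟨h0, h1⟩, rfl, rfl⟩
  have hvs : ∀ u i, ∀ s ∈ Set.Ioo (0 : ℝ) 1, vertex H u ≠ seg (d i) s := by
    intro u i s hs h
    have hs' := Set.Ioo_subset_Icc_self hs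
    have h1 := congrArg (fun x => x.coord (d i).fst) h
    have h2 := congrArg (fun x => x.coord (d i).snd) h
    simp only [seg_coord_fst _ hs', seg_coord_snd _ hs', vertex_coord] at h1 h2
    split_ifs at h2 <;> linarith [hs.1, hs.2]
  have hker : ∀ a b, f a = f b ↔ g a = g b := by
    intro a b
    rcases norm a with ⟨w, h1, h2⟩ | ⟨i, s, hs, h1, h2⟩ <;>
      rcases norm b with ⟨w', h1', h2'⟩ | ⟨j, s', hs', h1', h2'⟩ <;> rw [h1, h2, h1', h2']
    · refine ⟨fun h => by rw [Subtype.ext h], fun h => ?_⟩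
      have h3 := congrArg (fun x => x.coord (e w)) h
      simp only [vertex_coord, if_true] at h3
      split_ifs at h3 with h4
      · rw [e.injective h4]
      · exact absurd h3 one_ne_zero
    · exact iff_of_false (fun h => D.arc_notMem j s' hs' (h ▸ w.2)) (hvs _ _ _ hs')
    · exact iff_of_false (fun h => D.arc_notMem i s hs (h ▸ w'.2)) (hvs _ _ _ hs).symm
    · constructor
      · intro h
        obtain ⟨rfl, rfl⟩ := D.arc_inj i j s hs s' hs' h
        rfl
      · intro h
        have h3 := hdinj j i (eq_or_eq_symm_of_onDart hs (h ▸ onDart_seg (d j) s'))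
        subst h3
        rw [seg_injOn _ (Set.Ioo_subset_Icc_self hs) (Set.Ioo_subset_Icc_self hs') h]
  have hfs : f.Surjective := fun y => by
    rcases D.cover y with h | ⟨i, s, hs, rfl⟩
    · exact ⟨Sum.inl ⟨y, h⟩, rfl⟩
    · exact ⟨Sum.inr ⟨i, s, Set.Ioo_subset_Icc_self hs⟩, rfl⟩
  have hgs : g.Surjective := fun x => by
    rcases eq_vertex_or_seg x with ⟨v, rfl⟩ | ⟨⟨⟨u, v⟩, huv⟩, t, ht, rfl⟩
    · exact ⟨Sum.inl (e.symm v), by simp [g]⟩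
    · obtain ⟨i, h | h⟩ := huv
      · refine ⟨Sum.inr ⟨i, t, ht⟩, ?_⟩
        change seg (d i) t = _
        congr 1
        refine SimpleGraph.Dart.ext _ _ (Prod.ext ?_ ?_)
        · exact e.symm.injective (Subtype.ext ((hd0 i).trans h.1.symm))
        · exact e.symm.injective (Subtype.ext ((hd1 i).trans h.2.symm))
      · refine ⟨Sum.inr ⟨i, 1 - t, by linarith [ht.2], by linarith [ht.1]⟩, ?_⟩
        change seg (d i) (1 - t) = _
        rw [← seg_symm (d i) ht]
        congr 1
        refine SimpleGraph.Dart.ext _ _ (Prod.ext ?_ ?_)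
        · exact e.symm.injective (Subtype.ext ((hd1 i).trans h.1.symm))
        · exact e.symm.injective (Subtype.ext ((hd0 i).trans h.2.symm))
  obtain ⟨φ⟩ := nonempty_homeomorph_of_ker_eq hf hg hfs hgs hker
  exact ⟨⟨n, H, φ⟩⟩

theorem mem_Ioo_third (k : Fin 3) {s : ℝ} (hs : s ∈ Set.Ioo (0 : ℝ) 1) :
    ((k : ℕ) + s) / 3 ∈ Set.Ioo (0 : ℝ) 1 := by
  obtain ⟨h0, h1⟩ := hs
  have : ((k : ℕ) : ℝ) ≤ 2 := by exact_mod_cast Nat.le_of_lt_succ k.2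
  constructor
  · positivity
  · linarith

/-- Every arc is cut into three. -/
def subdivide [Finite ι] : ArcDecomposition Y (ι × Fin 3) where
  nodes := D.nodes ∪ Set.range fun p : ι × Bool => D.arc p.1 (if p.2 then 1 / 3 else 2 / 3)
  finite_nodes := D.finite_nodes.union (Set.finite_range _)
  nonempty_nodes := D.nonempty_nodes.mono Set.subset_union_left
  arc p s := D.arc p.1 (((p.2 : ℕ) + s) / 3)
  continuous_arc p := (D.continuous_arc p.1).comp (by fun_prop)
  arc_zero := by
    rintro ⟨i, k⟩
    fin_cases k
    · left; simpa using D.arc_zero i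
    · right; exact ⟨(i, true), by norm_num⟩
    · right; exact ⟨(i, false), by norm_num⟩
  arc_one := by
    rintro ⟨i, k⟩
    fin_cases k
    · right; exact ⟨(i, true), by norm_num⟩
    · right; exact ⟨(i, false), by norm_num⟩
    · left
      have := D.arc_one i
      norm_num at this ⊢
      exact this
  arc_notMem := by
    rintro ⟨i, k⟩ s hs (h | ⟨⟨j, b⟩, h⟩)
    · exact D.arc_notMem i _ (mem_Ioo_third k hs) h
    · have h1 := (D.arc_inj i j _ (mem_Ioo_third k hs) _ (by cases b <;> norm_num) h.symm).2
      obtain ⟨h0, h2⟩ := hs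
      fin_cases k <;> cases b <;> norm_num at h1 <;> linarith
  arc_inj := by
    rintro ⟨i, k⟩ ⟨j, l⟩ s hs s' hs' h
    obtain ⟨rfl, h1⟩ := D.arc_inj i j _ (mem_Ioo_third k hs) _ (mem_Ioo_third l hs') h
    obtain ⟨h0, h2⟩ := hs
    obtain ⟨h0', h2'⟩ := hs'
    have hkl : k = l := by
      fin_cases k <;> fin_cases l <;> first | rfl | (exfalso; norm_num at h1; linarith)
    subst hkl
    exact ⟨rfl, by linarith⟩
  cover y := by
    rcases D.cover y with h | ⟨i, s, ⟨h0, h1⟩, rfl⟩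
    · exact Or.inl (Or.inl h)
    rcases lt_trichotomy s (1 / 3) with h | h | h
    · exact Or.inr ⟨(i, 0), 3 * s, ⟨by linarith, by linarith⟩, by congr 1; norm_num⟩
    · exact Or.inl (Or.inr ⟨(i, true), by simp [h]⟩)
    rcases lt_trichotomy s (2 / 3) with h' | h' | h'
    · exact Or.inr ⟨(i, 1), 3 * s - 1, ⟨by linarith, by linarith⟩, by congr 1; norm_num⟩
    · exact Or.inl (Or.inr ⟨(i, false), by simp [h']⟩)
    · exact Or.inr ⟨(i, 2), 3 * s - 2, ⟨by linarith, by linarith⟩, by congr 1; norm_num⟩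

set_option linter.unusedTactic false in
-- Arcs may be loops or share both ends. After the cut every small arc has an end interior to its
-- old arc, and by `arc_inj'` that end reveals the old arc and the parameter.
theorem isSimple_subdivide [Finite ι] : D.subdivide.IsSimple := by
  have key : ∀ {i j x y}, D.arc i x = D.arc j y → x ∈ Set.Ioo (0 : ℝ) 1 →
    y ∈ Set.Icc (0 : ℝ) 1 → i = j ∧ x = y := fun h hx hy => D.arc_inj' hx hy h
  constructor
  · rintro ⟨i, k⟩ h
    simp only [subdivide] at h
    fin_cases k
    · have := (key h.symm (by norm_num) (by norm_num)).2
      norm_num at this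
    · have := (key h (by norm_num) (by norm_num)).2
      norm_num at this
    · have := (key h (by norm_num) (by norm_num)).2
      norm_num at this
  · rintro ⟨i, k⟩ ⟨j, l⟩ h1 h2
    simp only [subdivide] at h1 h2
    fin_cases k <;> fin_cases l <;>
    first
      | (refine Prod.ext (key h1 ?_ ?_).1 rfl <;> norm_num; done)
      | (refine Prod.ext (key h2 ?_ ?_).1 rfl <;> norm_num; done)
      | (refine absurd (key h1 ?_ ?_).2 ?_ <;> norm_num; done)
      | (refine absurd (key h2 ?_ ?_).2 ?_ <;> norm_num; done)
  · rintro ⟨i, k⟩ ⟨j, l⟩ h1 h2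
    simp only [subdivide] at h1 h2
    fin_cases k <;> fin_cases l <;>
    first
      | (refine absurd (key h1 ?_ ?_).2 ?_ <;> norm_num; done)
      | (refine absurd (key h2 ?_ ?_).2 ?_ <;> norm_num; done)
      | (refine absurd (key h1.symm ?_ ?_).2 ?_ <;> norm_num; done)
      | (refine absurd (key h2.symm ?_ ?_).2 ?_ <;> norm_num; done)

theorem nonempty_triangulation [T2Space Y] [Finite ι] (D : ArcDecomposition Y ι) :
    Nonempty (Triangulation Y) :=
  D.isSimple_subdivide.nonempty_triangulation

end ArcDecomposition

end

section

/-! ### Connectedness of metric graphs -/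

section Connected

variable {V : Type*} [Fintype V] {G : SimpleGraph V}

/-- The total barycentric weight on the component of `v` is continuous with values in `{0, 1}`,
hence constant. -/
theorem connected_of_preconnectedSpace [PreconnectedSpace (Point G)] [Nonempty (Point G)] :
    G.Connected := by
  classical
  have hV : Nonempty V := by
    obtain ⟨x⟩ := ‹Nonempty (Point G)›
    obtain ⟨u, -⟩ := x.mem_simplex
    exact ⟨u⟩
  refine ⟨fun v w => ?_⟩
  let f : Point G → ℝ := fun x => ∑ u, if G.Reachable v u then x.coord u else 0
  have hf : Continuous f := continuous_finsetSum _ fun u _ => by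
    split_ifs
    · exact (continuous_apply u).comp continuous_coord
    · exact continuous_const
  have hv : f (vertex G v) = 1 := by
    refine (Finset.sum_eq_single v (fun u _ hu => ?_) (by simp)).trans ?_
    · simp [vertex_coord, hu]
    · rw [if_pos (SimpleGraph.Reachable.refl _), vertex_coord, if_pos rfl]
  have h01 : ∀ x, f x = 0 ∨ f x = 1 := by
    intro x
    obtain ⟨a, b, hab, hx⟩ := x.mem_simplex
    have hr : G.Reachable a b := by
      rcases hab with rfl | hab
      exacts [SimpleGraph.Reachable.refl _, hab.reachable]
    by_cases h : G.Reachable v a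
    · right
      rw [← x.sum_coord]
      refine Finset.sum_congr rfl fun u _ => ?_
      by_cases hu : x.coord u = 0
      · simp [hu]
      · rcases hx u hu with rfl | rfl
        · rw [if_pos h]
        · rw [if_pos (h.trans hr)]
    · left
      refine Finset.sum_eq_zero fun u _ => ?_
      by_cases hu : x.coord u = 0
      · simp [hu]
      · rcases hx u hu with rfl | rfl
        · rw [if_neg h]
        · rw [if_neg fun h' => h (h'.trans hr.symm)]
  have hclopen : IsClopen (f ⁻¹' {1}) := by
    refine ⟨isClosed_singleton.preimage hf, ?_⟩
    have : f ⁻¹' {1} = (f ⁻¹' {0})ᶜ := by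
      ext x
      rcases h01 x with h | h <;> simp [h]
    rw [this]
    exact (isClosed_singleton.preimage hf).isOpen_compl
  rcases isClopen_iff.1 hclopen with h | h
  · exact absurd (show vertex G v ∈ f ⁻¹' {1} from hv) (by simp [h])
  · have hw : f (vertex G w) = 1 := by
      have : vertex G w ∈ f ⁻¹' {1} := h ▸ Set.mem_univ _
      exact this
    by_contra hn
    have : f (vertex G w) = 0 := by
      refine Finset.sum_eq_zero fun u _ => ?_
      by_cases hu : u = w
      · rw [hu, if_neg hn]
      · simp [vertex_coord, hu]
    linarith

/-- A metric graph stays connected when at most one interior point is removed from each of the edges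
outside a connected spanning subgraph. -/
theorem isPreconnected_compl_range {F : SimpleGraph V} (hF : F.Connected) (hFG : F ≤ G) {κ : Type*}
    (d : κ → G.Dart) (r : κ → ℝ) (hr : ∀ k, r k ∈ Set.Ioo (0 : ℝ) 1)
    (hd : Function.Injective fun k => (d k).edge) (hdF : ∀ k, (d k).edge ∉ F.edgeSet) :
    IsPreconnected (Set.range fun k => seg (d k) (r k))ᶜ := by
  set R := Set.range fun k => seg (d k) (r k) with hR
  have mem : ∀ (e : G.Dart) t, seg e t ∈ R → ∃ k, (d k).edge = e.edge ∧ seg e t = seg (d k) (r k) := by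
    rintro e t ⟨k, hk⟩
    refine ⟨k, ?_, hk.symm⟩
    dsimp only at hk
    rcases eq_or_eq_symm_of_onDart (hr k) (hk ▸ onDart_seg e t) with h | h
    · rw [h]
    · rw [h, SimpleGraph.Dart.edge_symm]
  have join_trans : ∀ {x y z : Point G},
      (∃ t ⊆ Rᶜ, x ∈ t ∧ y ∈ t ∧ IsPreconnected t) →
      (∃ t ⊆ Rᶜ, y ∈ t ∧ z ∈ t ∧ IsPreconnected t) →
      ∃ t ⊆ Rᶜ, x ∈ t ∧ z ∈ t ∧ IsPreconnected t := by
    rintro x y z ⟨t, ht, hx, hy, h⟩ ⟨t', ht', hy', hz, h'⟩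
    exact ⟨t ∪ t', Set.union_subset ht ht', Or.inl hx, Or.inr hz, h.union y hy hy' h'⟩
  have join_symm : ∀ {x y : Point G},
      (∃ t ⊆ Rᶜ, x ∈ t ∧ y ∈ t ∧ IsPreconnected t) →
      ∃ t ⊆ Rᶜ, y ∈ t ∧ x ∈ t ∧ IsPreconnected t := by
    rintro x y ⟨t, ht, hx, hy, h⟩
    exact ⟨t, ht, hy, hx, h⟩
  have join_seg : ∀ (e : G.Dart) (a b : ℝ), a ≤ b → (∀ t ∈ Set.Icc a b, seg e t ∉ R) →
      ∃ t ⊆ Rᶜ, seg e a ∈ t ∧ seg e b ∈ t ∧ IsPreconnected t := by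
    intro e a b hab h
    refine ⟨seg e '' Set.Icc a b, ?_, ⟨a, ⟨le_rfl, hab⟩, rfl⟩, ⟨b, ⟨hab, le_rfl⟩, rfl⟩,
      isPreconnected_Icc.image _ (continuous_seg e).continuousOn⟩
    rintro _ ⟨t, ht, rfl⟩
    exact h t ht
  have vertex_notMem : ∀ v, vertex G v ∉ R := by
    rintro v ⟨k, hk⟩
    have hk' := Set.Ioo_subset_Icc_self (hr k)
    have h2 := congrArg (fun x => x.coord (d k).snd) hk
    simp only [seg_coord_snd _ hk', vertex_coord] at h2
    split_ifs at h2 <;> linarith [(hr k).1, (hr k).2]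
  have join_vertex : ∀ u v, F.Walk u v →
      ∃ t ⊆ Rᶜ, vertex G u ∈ t ∧ vertex G v ∈ t ∧ IsPreconnected t := by
    intro u v p
    induction p with
    | @nil u => exact ⟨{vertex G u}, by simpa using vertex_notMem u, rfl, rfl, isPreconnected_singleton⟩
    | @cons u v w h p ih =>
      refine join_trans ?_ ih
      have := join_seg ⟨(u, v), hFG h⟩ 0 1 zero_le_one fun t _ ht => by
        obtain ⟨k, hk, -⟩ := mem _ _ ht
        exact hdF k (by rw [hk]; exact h)
      rwa [seg_zero, seg_one] at this
  have join : ∀ x ∈ Rᶜ, ∃ v, ∃ t ⊆ Rᶜ, vertex G v ∈ t ∧ x ∈ t ∧ IsPreconnected t := by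
    intro x hx
    rcases eq_vertex_or_seg x with ⟨v, rfl⟩ | ⟨e, t, ht, rfl⟩
    · exact ⟨v, {vertex G v}, by simpa using vertex_notMem v, rfl, rfl, isPreconnected_singleton⟩
    -- The edge carries at most one removed point, so at least one of the two ways from `x` to an
    -- end is free.
    by_cases h : ∀ s ∈ Set.Icc 0 t, seg e s ∉ R
    · have := join_seg e 0 t ht.1 h
      rw [seg_zero] at this
      exact ⟨_, this⟩
    · push Not at h
      obtain ⟨s, hs, hsR⟩ := h
      refine ⟨e.snd, join_symm ?_⟩
      rw [← seg_one]
      refine join_seg e t 1 ht.2 fun s' hs' hsR' => ?_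
      obtain ⟨k, hk, hks⟩ := mem e s hsR
      obtain ⟨k', hk', hks'⟩ := mem e s' hsR'
      obtain rfl := hd (hk.trans hk'.symm)
      have := seg_injOn e ⟨hs.1, hs.2.trans ht.2⟩ ⟨ht.1.trans hs'.1, hs'.2⟩ (hks.trans hks'.symm)
      subst this
      obtain rfl := le_antisymm hs.2 hs'.1
      exact hx hsR
  refine isPreconnected_of_forall_pair fun x hx y hy => ?_
  obtain ⟨u, hu⟩ := join x hx
  obtain ⟨v, hv⟩ := join y hy
  obtain ⟨p⟩ := hF.preconnected u v
  exact join_trans (join_symm hu) (join_trans (join_vertex u v p) hv)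

theorem preconnectedSpace_point (hG : G.Connected) : PreconnectedSpace (Point G) := by
  have := isPreconnected_compl_range hG le_rfl (κ := Empty) Empty.elim Empty.elim (by simp)
    (fun k => k.elim) (by simp)
  rw [Set.range_eq_empty, Set.compl_empty] at this
  exact ⟨this⟩

end Connected

/-! ### Counting the edges of a triangulation -/

namespace ArcDecomposition

variable {Y ι : Type*} [TopologicalSpace Y] (D : ArcDecomposition Y ι)

theorem isOpen_image_arc [T2Space Y] [Finite ι] (i : ι) {a b : ℝ} (ha : 0 ≤ a) (hb : b ≤ 1) :
    IsOpen (D.arc i '' Set.Ioo a b) := by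
  have hc : ∀ j x y, IsClosed (D.arc j '' Set.Icc x y) := fun j x y =>
    (isCompact_Icc.image (D.continuous_arc j)).isClosed
  -- The complement is a finite union of compact sets. The `min` and `max` keep parameters in `[0,
  -- 1]`, outside of which nothing is assumed about the arcs.
  have : (D.arc i '' Set.Ioo a b)ᶜ = D.nodes ∪ ((⋃ j : {j // j ≠ i}, D.arc j '' Set.Icc 0 1) ∪
      (D.arc i '' Set.Icc 0 (min a 1) ∪ D.arc i '' Set.Icc (max b 0) 1)) := by
    have hsub : ∀ s ∈ Set.Ioo a b, s ∈ Set.Ioo (0 : ℝ) 1 := fun s hs =>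
      ⟨ha.trans_lt hs.1, hs.2.trans_le hb⟩
    refine Set.Subset.antisymm (fun y hy => ?_) ?_
    · rcases D.cover y with h | ⟨j, s, hs, rfl⟩
      · exact Or.inl h
      refine Or.inr ?_
      by_cases hj : j = i
      · subst hj
        right
        rcases le_or_gt s a with h | h
        · exact Or.inl ⟨s, ⟨hs.1.le, le_min h hs.2.le⟩, rfl⟩
        rcases le_or_gt b s with h' | h'
        · exact Or.inr ⟨s, ⟨max_le h' hs.1.le, hs.2.le⟩, rfl⟩
        · exact absurd ⟨s, ⟨h, h'⟩, rfl⟩ hy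
      · exact Or.inl (Set.mem_iUnion.2 ⟨⟨j, hj⟩, s, Set.Ioo_subset_Icc_self hs, rfl⟩)
    · rintro y hy ⟨s, hs, rfl⟩
      rcases hy with h | h | ⟨x, hx, h⟩ | ⟨x, hx, h⟩
      · exact D.arc_notMem i s (hsub s hs) h
      · obtain ⟨⟨j, hj⟩, x, hx, h⟩ := Set.mem_iUnion.1 h
        exact hj (D.arc_inj' (hsub s hs) hx h.symm).1.symm
      · have := (D.arc_inj' (hsub s hs) ⟨hx.1, hx.2.trans (min_le_right _ _)⟩ h.symm).2
        linarith [hs.1, hx.2.trans (min_le_left _ _)]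
      · have := (D.arc_inj' (hsub s hs) ⟨(le_max_right _ _).trans hx.1, hx.2⟩ h.symm).2
        linarith [hs.2, (le_max_left _ _).trans hx.1]
  rw [← isClosed_compl_iff, this]
  exact D.finite_nodes.isClosed.union ((isClosed_iUnion_of_finite fun j => hc _ _ _).union
    ((hc _ _ _).union (hc _ _ _)))

/-- Two points of one open arc disconnect the space. -/
theorem not_isPreconnected_compl [T2Space Y] [Finite ι] {R : Set Y} (hR : R.Finite)
    (hRn : Disjoint R D.nodes) (i : ι) {a b : ℝ} (ha : a ∈ Set.Ioo (0 : ℝ) 1)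
    (hb : b ∈ Set.Ioo (0 : ℝ) 1) (hab : a < b) (haR : D.arc i a ∈ R) (hbR : D.arc i b ∈ R) :
    ¬IsPreconnected Rᶜ := by
  intro h
  have hsub : ∀ s ∈ Set.Icc a b, s ∈ Set.Ioo (0 : ℝ) 1 := fun s hs =>
    ⟨ha.1.trans_le hs.1, hs.2.trans_lt hb.2⟩
  have hc : IsClosed (D.arc i '' Set.Icc a b) :=
    (isCompact_Icc.image (D.continuous_arc i)).isClosed
  obtain ⟨w, hw⟩ := D.nonempty_nodes
  have hinf : (D.arc i '' Set.Ioo a b).Infinite := (Set.Ioo_infinite hab).image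
    fun s hs s' hs' hss => (D.arc_inj i i s (hsub s (Set.Ioo_subset_Icc_self hs)) s'
      (hsub s' (Set.Ioo_subset_Icc_self hs')) hss).2
  -- Finiteness of `R` leaves a point strictly between the two removed ones; a node lies on the
  -- other side.
  obtain ⟨y, hy, hyR⟩ := (hinf.sdiff hR).nonempty
  have hcov : Rᶜ ⊆ D.arc i '' Set.Ioo a b ∪ (D.arc i '' Set.Icc a b)ᶜ := fun x hx => by
    by_cases hxc : x ∈ D.arc i '' Set.Icc a b
    · obtain ⟨s, hs, rfl⟩ := hxc
      refine Or.inl ⟨s, ⟨hs.1.lt_of_ne ?_, hs.2.lt_of_ne ?_⟩, rfl⟩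
      · rintro rfl; exact hx haR
      · rintro rfl; exact hx hbR
    · exact Or.inr hxc
  have hwc : w ∉ D.arc i '' Set.Icc a b := by
    rintro ⟨s, hs, rfl⟩
    exact D.arc_notMem i s (hsub s hs) hw
  obtain ⟨z, -, ⟨s, hs, rfl⟩, hz⟩ := h _ _ (D.isOpen_image_arc i ha.1.le hb.2.le)
    hc.isOpen_compl hcov ⟨y, hyR, hy⟩ ⟨w, Set.disjoint_right.1 hRn hw, hwc⟩
  exact hz ⟨s, Set.Ioo_subset_Icc_self hs, rfl⟩

/-- If there were more edges outside a spanning tree than arcs, one point chosen on each, off the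
nodes, would put two on a common arc. Removing all of them would both preserve and destroy
connectedness. -/
theorem ncard_edgeSet_add_one_le [T2Space Y] [Finite ι] (D : ArcDecomposition Y ι) {V : Type*} [Fintype V]
    {H : SimpleGraph V} (hH : H.Connected) (h : Point H ≃ₜ Y) :
    H.edgeSet.ncard + 1 ≤ Fintype.card V + Nat.card ι := by
  classical
  obtain ⟨F, hFH, hF⟩ := hH.exists_isTree_le
  have hFc : F.edgeSet.ncard + 1 = Fintype.card V := by
    rw [← hF.card_edgeFinset, ← SimpleGraph.coe_edgeFinset, Set.ncard_coe_finset]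
  have hsub : F.edgeSet ⊆ H.edgeSet := SimpleGraph.edgeSet_mono hFH
  have hdiff := Set.ncard_sdiff_add_ncard_of_subset hsub
  by_contra! hlt
  have hN : Nat.card ι < Nat.card ↥(H.edgeSet \ F.edgeSet) := by
    rw [Nat.card_coe_set_eq]; omega
  have hdart : ∀ e : ↥(H.edgeSet \ F.edgeSet), ∃ d : H.Dart, d.edge = e := by
    rintro ⟨e, he, -⟩
    induction e with
    | _ u v => exact ⟨⟨(u, v), he⟩, rfl⟩
  choose d hd using hdart
  have hpt : ∀ e, ∃ r ∈ Set.Ioo (0 : ℝ) 1, h (seg (d e) r) ∉ D.nodes := by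
    intro e
    have hinj : Set.InjOn (fun r => h (seg (d e) r)) (Set.Ioo 0 1) :=
      h.injective.comp_injOn ((seg_injOn (d e)).mono Set.Ioo_subset_Icc_self)
    obtain ⟨_, ⟨r, hr, rfl⟩, hn⟩ :=
      (((Set.Ioo_infinite zero_lt_one).image hinj).sdiff D.finite_nodes).nonempty
    exact ⟨r, hr, hn⟩
  choose r hr hrn using hpt
  have harc : ∀ e, ∃ i, ∃ s ∈ Set.Ioo (0 : ℝ) 1, h (seg (d e) (r e)) = D.arc i s := fun e =>
    (D.cover _).resolve_left (hrn e)
  choose i s hs his using harc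
  have hdinj : Function.Injective fun e => (d e).edge := fun e e' hee => by
    simp only [hd] at hee
    exact Subtype.ext hee
  obtain ⟨e, e', hne, hi⟩ : ∃ e e', e ≠ e' ∧ i e = i e' := by
    by_contra! hcon
    have hinj : Function.Injective i := fun e e' hee => by
      by_contra hne
      exact hcon e e' hne hee
    exact hN.not_ge (Nat.card_le_card_of_injective i hinj)
  have hss : s e ≠ s e' := by
    intro hse
    have h1 : seg (d e) (r e) = seg (d e') (r e') := h.injective (by rw [his, his, hi, hse])
    rcases eq_or_eq_symm_of_onDart (hr e) (h1 ▸ onDart_seg (d e') (r e')) with h2 | h2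
    · exact hne (hdinj (by simp only [h2]))
    · exact hne (hdinj (by simp only [h2, SimpleGraph.Dart.edge_symm]))
  have hpre : IsPreconnected (h '' (Set.range fun e => seg (d e) (r e)))ᶜ := by
    have := isPreconnected_compl_range hF.connected hFH d r hr hdinj fun e => by
      rw [hd]; exact e.2.2
    rw [← Set.image_compl_eq h.bijective]
    exact this.image h h.continuous.continuousOn
  have hfin : (h '' (Set.range fun e => seg (d e) (r e))).Finite := (Set.finite_range _).image _
  have hdisj : Disjoint (h '' (Set.range fun e => seg (d e) (r e))) D.nodes := by
    rw [Set.disjoint_left]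
    rintro _ ⟨_, ⟨e, rfl⟩, rfl⟩
    exact hrn e
  have hmem : ∀ e, D.arc (i e) (s e) ∈ h '' (Set.range fun e => seg (d e) (r e)) := fun e =>
    ⟨_, ⟨e, rfl⟩, his e⟩
  rcases hss.lt_or_gt with hlt' | hlt'
  · exact D.not_isPreconnected_compl hfin hdisj (i e) (hs e) (hs e') hlt' (hmem e)
      (hi ▸ hmem e') hpre
  · exact D.not_isPreconnected_compl hfin hdisj (i e) (hs e') (hs e) hlt' (hi ▸ hmem e')
      (hmem e) hpre

end ArcDecomposition

end

section

/-! ### The first homology group of a finite graph -/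

section Homology

variable {V : Type*} [Fintype V] {G : SimpleGraph V}

open Classical in
/-- The oriented edge from `u` to `v`, as a chain. -/
def edgeChain {u v : V} (h : G.Adj u v) : oneChains G where
  val a b := (if a = u ∧ b = v then 1 else 0) - (if a = v ∧ b = u then 1 else 0)
  property := by
    refine ⟨fun a b => ?_, fun a b hab => ?_⟩
    · rw [neg_sub]
      simp only [and_comm]
    · have h1 : ¬(a = u ∧ b = v) := by rintro ⟨rfl, rfl⟩; exact hab h
      have h2 : ¬(a = v ∧ b = u) := by rintro ⟨rfl, rfl⟩; exact hab h.symm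
      simp [h1, h2]

open Classical in
theorem boundary_edgeChain {u v : V} (h : G.Adj u v) :
    boundary G (edgeChain h) = Pi.single v 1 - Pi.single u 1 := by
  funext b
  simp only [boundary, edgeChain, AddMonoidHom.coe_mk, ZeroHom.coe_mk, Finset.sum_sub_distrib,
    ite_and, Finset.sum_ite_eq', Finset.mem_univ, if_true, Pi.sub_apply, Pi.single_apply]

open Classical in
theorem exists_boundary_eq {u v : V} (p : G.Walk u v) :
    ∃ c : oneChains G, boundary G c = Pi.single v 1 - Pi.single u 1 := by
  induction p with
  | nil => exact ⟨0, by simp⟩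
  | cons h p ih =>
    obtain ⟨c, hc⟩ := ih
    exact ⟨edgeChain h + c, by rw [map_add, hc, boundary_edgeChain]; abel⟩

/-- The coefficients of a chain on the edges, each with an arbitrary orientation. -/
def edgeCoeff {V : Type*} (G : SimpleGraph V) : oneChains G →ₗ[ℤ] (G.edgeSet → ℤ) :=
  AddMonoidHom.toIntLinearMap
    { toFun := fun c e => c.1 (Quot.out (e : Sym2 V)).1 (Quot.out (e : Sym2 V)).2
      map_zero' := rfl
      map_add' := fun _ _ => rfl }

theorem edgeCoeff_injective {V : Type*} {G : SimpleGraph V} : Function.Injective (edgeCoeff G) := by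
  rw [injective_iff_map_eq_zero]
  intro c hc
  refine Subtype.ext (funext fun u => funext fun v => ?_)
  by_cases h : G.Adj u v
  · have h1 := congrFun hc ⟨s(u, v), h⟩
    change c.1 (Quot.out s(u, v)).1 (Quot.out s(u, v)).2 = 0 at h1
    have h2 : s((Quot.out s(u, v)).1, (Quot.out s(u, v)).2) = s(u, v) := Quot.out_eq _
    rcases Sym2.eq_iff.1 h2 with ⟨h3, h4⟩ | ⟨h3, h4⟩
    · rwa [h3, h4] at h1
    · rw [h3, h4] at h1
      rw [c.2.1 v u, h1]; rfl
  · exact c.2.2 u v h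

instance : Module.Finite ℤ (oneChains G) := Module.Finite.of_injective _ edgeCoeff_injective

instance : Module.Finite ℤ (H1 G) :=
  Module.Finite.of_injective (H1 G).subtype.toIntLinearMap Subtype.val_injective

instance : Module.Free ℤ (H1 G) := inferInstance

/-- Paths from `v₀` give chains `c v` with boundary `v - v₀`, independent modulo cycles. So cycles
together with `ℤ ^ (|V| - 1)` embed in the 1-chains, whose rank is at most the number of edges. -/
theorem finrank_H1_add_card_le (hG : G.Connected) :
    Module.finrank ℤ (H1 G) + Fintype.card V ≤ G.edgeSet.ncard + 1 := by
  classical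
  obtain ⟨v₀⟩ := hG.nonempty
  choose c hc using fun v => exists_boundary_eq (hG.preconnected v₀ v).some
  let Φ : (H1 G × ({v // v ≠ v₀} → ℤ)) →ₗ[ℤ] oneChains G :=
    (H1 G).subtype.toIntLinearMap.coprod
      (Fintype.linearCombination ℤ fun v : {v // v ≠ v₀} => c v)
  have hΦ : Function.Injective Φ := by
    rw [injective_iff_map_eq_zero]
    rintro ⟨z, f⟩ hzf
    have h0 : (z : oneChains G) + ∑ v, f v • c v = 0 := hzf
    have hf : f = 0 := by
      funext v
      have h1 := congrArg (fun x => boundary G x v) h0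
      simp only [map_add, map_zero, map_sum, map_zsmul, hc, (AddMonoidHom.mem_ker).1 z.2, zero_add,
        Finset.sum_apply, Pi.smul_apply, Pi.sub_apply, Pi.single_apply, Pi.zero_apply] at h1
      rw [Finset.sum_eq_single v (fun w _ hw => by

        rw [if_neg fun h => hw (Subtype.ext h).symm, if_neg v.2, sub_zero, smul_zero]) (by simp)] at h1
      simpa [v.2] using h1
    rw [hf] at h0
    simp only [Pi.zero_apply, zero_smul, Finset.sum_const_zero, add_zero] at h0
    exact Prod.ext (Subtype.ext h0) hf
  have h1 := LinearMap.finrank_le_finrank_of_injective hΦ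
  have h2 := LinearMap.finrank_le_finrank_of_injective (edgeCoeff_injective (G := G))
  rw [Module.finrank_prod, Module.finrank_fintype_fun_eq_card, Fintype.card_subtype_compl,
    Fintype.card_subtype_eq] at h1
  rw [Module.finrank_fintype_fun_eq_card, ← Nat.card_eq_fintype_card, Nat.card_coe_set_eq] at h2
  have := Fintype.card_pos_iff.2 hG.nonempty
  omega

theorem nonempty_H1_equiv : Nonempty (H1 G ≃+ (Fin (Module.finrank ℤ (H1 G)) → ℤ)) :=
  ⟨(Module.finBasis ℤ (H1 G)).equivFun.toAddEquiv⟩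

end Homology

end

section

/-! ### The arcs of the projection -/

/-- The end of the `j`-th piece of a half-edge that is closer to the vertex. -/
def pieceStart (ε : ℝ) : Fin 3 → ℝ := ![0, cut ε, 1 / 2 - cut ε]

/-- The end of the `j`-th piece of a half-edge that is closer to the midpoint. -/
def pieceEnd (ε : ℝ) : Fin 3 → ℝ := ![cut ε, 1 / 2 - cut ε, 1 / 2]

theorem pieceInterval_eq (ε : ℝ) (j : Fin 3) :
    pieceInterval ε j = Set.Ioo (pieceStart ε j) (pieceEnd ε j) := by
  fin_cases j <;> rfl

theorem cut_mem (ε : ℝ) : 0 ≤ cut ε ∧ cut ε ≤ 1 / 4 := by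
  obtain ⟨K, e, he, he', -, hc⟩ := exists_eq_int_add_or_sub ε
  refine ⟨hc ▸ le_min he (by linarith), ?_⟩
  rw [hc]
  rcases le_total e (1 / 4) with h | h
  · exact min_le_of_left_le h
  · exact min_le_of_right_le (by linarith)

theorem pieceStart_mem (ε : ℝ) (j : Fin 3) : pieceStart ε j ∈ Set.Icc (0 : ℝ) (1 / 2) := by
  obtain ⟨h0, h1⟩ := cut_mem ε
  fin_cases j <;> simp [pieceStart] <;> (try constructor) <;> linarith

theorem pieceEnd_mem (ε : ℝ) (j : Fin 3) : pieceEnd ε j ∈ Set.Icc (0 : ℝ) (1 / 2) := by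
  obtain ⟨h0, h1⟩ := cut_mem ε
  fin_cases j <;> simp [pieceEnd] <;> (try constructor) <;> linarith

theorem pieceStart_notMem (ε : ℝ) (j k : Fin 3) : pieceStart ε k ∉ pieceInterval ε j := by
  obtain ⟨h0, h1⟩ := cut_mem ε
  rw [pieceInterval_eq]
  rintro ⟨h2, h3⟩
  fin_cases j <;> fin_cases k <;> simp [pieceStart, pieceEnd] at h2 h3 <;> linarith

theorem pieceEnd_notMem (ε : ℝ) (j k : Fin 3) : pieceEnd ε k ∉ pieceInterval ε j := by
  obtain ⟨h0, h1⟩ := cut_mem ε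
  rw [pieceInterval_eq]
  rintro ⟨h2, h3⟩
  fin_cases j <;> fin_cases k <;> simp [pieceStart, pieceEnd] at h2 h3 <;> linarith

theorem eq_of_mem_pieceInterval {ε t : ℝ} {j k : Fin 3} (hj : t ∈ pieceInterval ε j)
    (hk : t ∈ pieceInterval ε k) : j = k := by
  obtain ⟨h0, h1⟩ := cut_mem ε
  rw [pieceInterval_eq] at hj hk
  obtain ⟨h2, h3⟩ := hj
  obtain ⟨h4, h5⟩ := hk
  fin_cases j <;> fin_cases k <;>
    first
      | rfl
      | (exfalso; simp [pieceStart, pieceEnd] at h2 h3 h4 h5; linarith)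

theorem exists_pieceInterval (ε : ℝ) {t : ℝ} (ht : t ∈ Set.Icc (0 : ℝ) (1 / 2)) :
    (∃ j, t = pieceStart ε j ∨ t = pieceEnd ε j) ∨ ∃ j, t ∈ pieceInterval ε j := by
  simp only [pieceInterval_eq]
  rcases ht.1.eq_or_lt with h | h
  · exact Or.inl ⟨0, Or.inl h.symm⟩
  rcases lt_trichotomy t (cut ε) with h1 | h1 | h1
  · exact Or.inr ⟨0, h, h1⟩
  · exact Or.inl ⟨0, Or.inr h1⟩
  rcases lt_trichotomy t (1 / 2 - cut ε) with h2 | h2 | h2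
  · exact Or.inr ⟨1, h1, h2⟩
  · exact Or.inl ⟨1, Or.inr h2⟩
  rcases ht.2.eq_or_lt with h3 | h3
  · exact Or.inl ⟨2, Or.inr h3⟩
  · exact Or.inr ⟨2, h2, h3⟩

variable {V : Type*} [Fintype V] {G : SimpleGraph V}

/-- The map `p_ε` onto its image. -/
def proj (G : SimpleGraph V) (ε : ℝ) (x : Point G) : Projection G ε :=
  ⟨ballMap G ε x, Set.mem_range_self x⟩

theorem continuous_proj (ε : ℝ) : Continuous (proj G ε) := (continuous_ballMap ε).subtype_mk _

theorem proj_surjective (ε : ℝ) : Function.Surjective (proj G ε) := by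
  rintro ⟨_, x, rfl⟩
  exact ⟨x, rfl⟩

theorem proj_eq_iff {ε : ℝ} {x y : Point G} : proj G ε x = proj G ε y ↔
    Metric.closedEBall x (ENNReal.ofReal ε) = Metric.closedEBall y (ENNReal.ofReal ε) :=
  ⟨fun h => congrArg (fun z => ((z.1 : TopologicalSpace.Closeds (Point G)) : Set (Point G))) h,
    fun h => Subtype.ext (TopologicalSpace.Closeds.ext h)⟩

/-- The set counted by `collapsedCount`. -/
def collapsed (G : SimpleGraph V) (ε : ℝ) : Set (G.Dart × Fin 3) :=
  {p | (pieceInterval ε p.2).Nonempty ∧ ∀ t ∈ pieceInterval ε p.2,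
    Metric.closedEBall (seg p.1 t) (ENNReal.ofReal ε) = Set.univ}

theorem collapsedCount_eq (G : SimpleGraph V) (ε : ℝ) :
    collapsedCount G ε = (collapsed G ε).ncard := by
  refine congrArg Set.ncard (Set.ext fun p => and_congr_right fun _ => forall₂_congr fun t ht => ?_)
  have ht' := Icc_half_subset (Set.Ioo_subset_Icc_self (pieceInterval_subset ε p.2 ht))
  rw [seg_eq_onEdge _ ht']
  exact ⟨fun h => h ht', fun h _ => h⟩

/-- The nonempty pieces that are not collapsed. -/
def active (G : SimpleGraph V) (ε : ℝ) : Set (G.Dart × Fin 3) :=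
  {p | (pieceInterval ε p.2).Nonempty} \ collapsed G ε

/-- The factor 6 is two darts per edge times three pieces per dart; empty pieces make it an
inequality. -/
theorem ncard_active_add_collapsedCount_le (G : SimpleGraph V) (ε : ℝ) :
    (active G ε).ncard + collapsedCount G ε ≤ 6 * G.edgeSet.ncard := by
  classical
  rw [collapsedCount_eq, active, Set.ncard_sdiff_add_ncard_of_subset fun p hp => hp.1]
  refine (Set.ncard_le_card _).trans (le_of_eq ?_)
  rw [Nat.card_prod, Nat.card_fin, Nat.card_eq_fintype_card,
    G.dart_card_eq_twice_card_edges, ← SimpleGraph.coe_edgeFinset, Set.ncard_coe_finset]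
  ring

theorem active_ne_univ (hG : G.Connected) {ε : ℝ} (hε : 0 < ε) {p : G.Dart × Fin 3}
    (hp : p ∈ active G ε) {t : ℝ} (ht : t ∈ pieceInterval ε p.2) :
    Metric.closedEBall (seg p.1 t) (ENNReal.ofReal ε) ≠ Set.univ := fun h =>
  hp.2 ⟨hp.1, fun _ ht' => closedEBall_seg_eq_univ hG hε ht ht' h⟩

/-- Two pieces are identified if corresponding points have the same balls. -/
def pieceSetoid (G : SimpleGraph V) (ε : ℝ) : Setoid (active G ε) where
  r p q := p.1.2 = q.1.2 ∧ ∀ t ∈ pieceInterval ε p.1.2,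
    proj G ε (seg p.1.1 t) = proj G ε (seg q.1.1 t)
  iseqv :=
    { refl := fun _ => ⟨rfl, fun _ _ => rfl⟩
      symm := fun h => ⟨h.1.symm, fun t ht => (h.2 t (h.1 ▸ ht)).symm⟩
      trans := fun h h' => ⟨h.1.trans h'.1, fun t ht => (h.2 t ht).trans (h'.2 t (h.1 ▸ ht))⟩ }

/-- The affine parametrization of the `j`-th piece by the unit interval. -/
def pieceParam (ε : ℝ) (j : Fin 3) (s : ℝ) : ℝ :=
  pieceStart ε j + s * (pieceEnd ε j - pieceStart ε j)

theorem pieceParam_mem {ε : ℝ} {j : Fin 3} (hj : (pieceInterval ε j).Nonempty) {s : ℝ}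
    (hs : s ∈ Set.Ioo (0 : ℝ) 1) : pieceParam ε j s ∈ pieceInterval ε j := by
  rw [pieceInterval_eq] at hj ⊢
  have h := sub_pos.2 (Set.nonempty_Ioo.1 hj)
  constructor <;> rw [pieceParam] <;> nlinarith [hs.1, hs.2]

theorem pieceParam_injective {ε : ℝ} {j : Fin 3} (hj : (pieceInterval ε j).Nonempty) :
    Function.Injective (pieceParam ε j) := by
  rw [pieceInterval_eq] at hj
  have h := sub_pos.2 (Set.nonempty_Ioo.1 hj)
  intro s s' hs
  exact mul_right_cancel₀ h.ne' (add_left_cancel hs)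

theorem exists_pieceParam_eq {ε t : ℝ} {j : Fin 3} (ht : t ∈ pieceInterval ε j) :
    ∃ s ∈ Set.Ioo (0 : ℝ) 1, t = pieceParam ε j s := by
  rw [pieceInterval_eq] at ht
  have h : 0 < pieceEnd ε j - pieceStart ε j := by linarith [ht.1, ht.2]
  refine ⟨(t - pieceStart ε j) / (pieceEnd ε j - pieceStart ε j),
    ⟨div_pos (by linarith [ht.1]) h, (div_lt_one h).2 (by linarith [ht.2])⟩, ?_⟩
  rw [pieceParam, div_mul_cancel₀ _ h.ne']; ring

/-- The images of the cut points of the edges and of the collapsed pieces. -/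
def projNodes (G : SimpleGraph V) (ε : ℝ) : Set (Projection G ε) :=
  Set.range (fun v => proj G ε (vertex G v)) ∪
    (Set.range (fun p : G.Dart × Fin 3 => proj G ε (seg p.1 (pieceStart ε p.2))) ∪
      (Set.range (fun p : G.Dart × Fin 3 => proj G ε (seg p.1 (pieceEnd ε p.2))) ∪
        {y | ((y : TopologicalSpace.Closeds (Point G)) : Set (Point G)) = Set.univ}))

theorem finite_projNodes (G : SimpleGraph V) (ε : ℝ) : (projNodes G ε).Finite := by
  refine (Set.finite_range _).union ((Set.finite_range _).union ((Set.finite_range _).union ?_))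
  refine Set.Subsingleton.finite fun y hy z hz => ?_
  exact Subtype.ext (TopologicalSpace.Closeds.ext (hy.trans hz.symm))

theorem proj_seg_notMem_projNodes (hG : G.Connected) {ε : ℝ} (hε : 0 < ε) {p : G.Dart × Fin 3}
    (hp : p ∈ active G ε) {t : ℝ} (ht : t ∈ pieceInterval ε p.2) :
    proj G ε (seg p.1 t) ∉ projNodes G ε := by
  have hu := active_ne_univ hG hε hp ht
  have hI := pieceInterval_subset ε p.2 ht
  have key : ∀ (d : G.Dart) (t' : ℝ), t' ∈ Set.Icc (0 : ℝ) (1 / 2) →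
      proj G ε (seg d t') = proj G ε (seg p.1 t) → t = t' := fun d t' ht' h =>
    eq_of_closedEBall_seg_eq hG hε (Set.Ioo_subset_Icc_self hI) ht' (proj_eq_iff.1 h.symm) hu
  rintro (⟨v, h⟩ | ⟨q, h⟩ | ⟨q, h⟩ | h)
  · obtain ⟨d, rfl⟩ := exists_dart_fst hG p.1 v
    dsimp only at h
    rw [← seg_zero] at h
    exact hI.1.ne' (key d 0 (by simp) h)
  · exact pieceStart_notMem ε p.2 q.2 (key _ _ (pieceStart_mem ε q.2) h ▸ ht)
  · exact pieceEnd_notMem ε p.2 q.2 (key _ _ (pieceEnd_mem ε q.2) h ▸ ht)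
  · exact hu h

/-- The projection is glued from the images of the pieces that are not collapsed. -/
def projDecomposition (hG : G.Connected) {ε : ℝ} (hε : 0 < ε) :
    ArcDecomposition (Projection G ε) (Quotient (pieceSetoid G ε)) where
  nodes := projNodes G ε
  finite_nodes := finite_projNodes G ε
  nonempty_nodes := ⟨_, Or.inl ⟨hG.nonempty.some, rfl⟩⟩
  arc q s := proj G ε (seg q.out.1.1 (pieceParam ε q.out.1.2 s))
  continuous_arc q := (continuous_proj ε).comp ((continuous_seg _).comp (by
    unfold pieceParam; fun_prop))
  arc_zero q := Or.inr (Or.inl ⟨q.out.1, by simp [pieceParam]⟩)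
  arc_one q := Or.inr (Or.inr (Or.inl ⟨q.out.1, by simp [pieceParam]⟩))
  arc_notMem q s hs := proj_seg_notMem_projNodes hG hε q.out.2 (pieceParam_mem q.out.2.1 hs)
  arc_inj q q' s hs s' hs' h := by
    have ht := pieceParam_mem q.out.2.1 hs
    have ht' := pieceParam_mem q'.out.2.1 hs'
    -- Rigidity gives equal parameters and hence the same piece index; constancy then identifies the
    -- two pieces throughout.
    have heq := eq_of_closedEBall_seg_eq hG hε
      (Set.Ioo_subset_Icc_self (pieceInterval_subset _ _ ht))
      (Set.Ioo_subset_Icc_self (pieceInterval_subset _ _ ht')) (proj_eq_iff.1 h)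
      (active_ne_univ hG hε q.out.2 ht)
    have hj := eq_of_mem_pieceInterval (heq ▸ ht) ht'
    have hq : q = q' := Quotient.out_equiv_out.1 ⟨hj, fun t ht₁ => proj_eq_iff.2 <|
      closedEBall_seg_congr hG hε ht ht₁ (by rw [proj_eq_iff, ← heq] at h; exact h)⟩
    subst hq
    exact ⟨rfl, pieceParam_injective q.out.2.1 heq⟩
  cover y := by
    obtain ⟨x, rfl⟩ := proj_surjective ε y
    rcases eq_vertex_or_seg x with ⟨v, rfl⟩ | ⟨d, t, -, rfl⟩
    · exact Or.inl (Or.inl ⟨v, rfl⟩)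
    obtain ⟨d', t', ht', hx⟩ := exists_half_seg hG d (seg d t)
    rw [hx]
    rcases exists_pieceInterval ε ht' with ⟨j, rfl | rfl⟩ | ⟨j, hj⟩
    · exact Or.inl (Or.inr (Or.inl ⟨(d', j), rfl⟩))
    · exact Or.inl (Or.inr (Or.inr (Or.inl ⟨(d', j), rfl⟩)))
    by_cases hc : (d', j) ∈ collapsed G ε
    -- A collapsed piece maps to the node given by the whole graph.
    · exact Or.inl (Or.inr (Or.inr (Or.inr (hc.2 t' hj))))
    · right
      let p : active G ε := ⟨(d', j), ⟨t', hj⟩, hc⟩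
      obtain ⟨s, hs, rfl⟩ := exists_pieceParam_eq hj
      obtain ⟨h1, h2⟩ := (pieceSetoid G ε).symm (Quotient.mk_out (s := pieceSetoid G ε) p)
      refine ⟨Quotient.mk _ p, s, hs, ?_⟩
      rw [← h1]
      exact h2 _ hj

theorem card_pieces_add_collapsedCount_le (G : SimpleGraph V) (ε : ℝ) :
    Nat.card (Quotient (pieceSetoid G ε)) + collapsedCount G ε ≤ 6 * G.edgeSet.ncard := by
  refine le_trans (Nat.add_le_add_right ?_ _) (ncard_active_add_collapsedCount_le G ε)
  rw [← Nat.card_coe_set_eq]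
  exact Nat.card_le_card_of_surjective _ Quotient.mk_surjective

theorem Triangulation.connected (hG : G.Connected) {ε : ℝ}
    (T : Triangulation (Projection G ε)) : T.graph.Connected := by
  have := preconnectedSpace_point hG
  have : PreconnectedSpace (Projection G ε) :=
    ⟨(proj_surjective (G := G) ε).range_eq ▸ isPreconnected_range (continuous_proj ε)⟩
  have : PreconnectedSpace (Point T.graph) :=
    ⟨T.homeo.symm.surjective.range_eq ▸ isPreconnected_range T.homeo.symm.continuous⟩
  have : Nonempty (Point T.graph) := ⟨T.homeo.symm (proj G ε (vertex G hG.nonempty.some))⟩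
  exact connected_of_preconnectedSpace

end

end MetricGraph

end

theorem proposition5p34 {V : Type*} [Fintype V] (G : SimpleGraph V) (hG : G.Connected)
    (ε : ℝ) (hε : 0 < ε) :
    Nonempty (MetricGraph.Triangulation (MetricGraph.Projection G ε)) ∧
    ∀ T : MetricGraph.Triangulation (MetricGraph.Projection G ε),
      1 - 6 * (G.edgeSet.ncard : ℤ) ≤ MetricGraph.eulerChar T.graph ∧
      1 + (MetricGraph.collapsedCount G ε : ℤ) - 6 * (G.edgeSet.ncard : ℤ) ≤
        MetricGraph.eulerChar T.graph ∧
      ∃ m : ℕ, Nonempty (MetricGraph.H1 T.graph ≃+ (Fin m → ℤ)) ∧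
        (m : ℤ) ≤ 6 * (G.edgeSet.ncard : ℤ) - (MetricGraph.collapsedCount G ε : ℤ) := by
  have D := MetricGraph.projDecomposition hG hε
  refine ⟨D.nonempty_triangulation, fun T => ?_⟩
  have hT := T.connected hG
  have h1 := D.ncard_edgeSet_add_one_le hT T.homeo
  have h2 := MetricGraph.card_pieces_add_collapsedCount_le G ε
  have h3 := MetricGraph.finrank_H1_add_card_le hT
  refine ⟨?_, ?_, _, MetricGraph.nonempty_H1_equiv, ?_⟩
  -- Only the number of arcs links the given triangulation to the projection; the collapsed pieces
  -- have already been subtracted from it.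
  · rw [MetricGraph.eulerChar]; omega
  · rw [MetricGraph.eulerChar]; omega
  · omega
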